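/- **Setting.** Let $\mathcal A$ be a finite alphabet, $\mathbb B(r)=[-r,r]^D\subset\mathbb Z^D$, $\sigma^{z}$ the shift $\sigma^z(\mathbf a)_y=a_{y+z}$, $\mathbb E$ the set of unit steps $(0,\dots,0,\pm1,0,\dots,0)$. Let $\mathfrak A\subset\mathcal A^{\mathbb Z^D}$ be a subshift. A block on $\mathbb B(z,r)=z+\mathbb B(r)$ is admissible if it is the restriction (after translation to $\mathbb B(r)$) of an element of $\mathfrak A$. For a configuration $\mathbf a$ let $\mathcal F_{\mathbf a}(z)\in\mathbb N\cup\{\infty\}$ be the largest $r$ such that $\mathbf a_{\mathbb B(z,r)}$ is admissible, $\mathbb G_r(\mathbf a)=\{z:\mathcal F_{\mathbf a}(z)\ge r\}$, and $\widetilde{\mathfrak A}=\{\mathbf a:\sup_z\mathcal F_{\mathbf a}(z)=\infty\}$; $\mathbf a$ is defective if $\mathbf a\in\widetilde{\mathfrak A}\setminus\mathfrak A$. All coefficient groups are discrete. A ($G$-valued) cocycle is a continuous $C:\mathbb Z^D\times\mathfrak A\to G$ with $C(y+z,\mathbf x)=C(y,\sigma^z\mathbf x)\,C(z,\mathbf x)$;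 $C\approx C'$ means $C'(z,\mathbf x)=b(\sigma^z\mathbf x)C(z,\mathbf x)b(\mathbf x)^{-1}$ for a continuous $b:\mathfrak A\to G$. $H^1_{dy}(\mathfrak A,G)$ is the set of $\approx$-classes; for abelian $G$ it may equally be taken to be the group of cocycles modulo those cohomologous to a homomorphism $\mathbb Z^D\to G$ (the statement holds for both versions). $C$ is locally determined with radius $r$ if for each $e\in\mathbb E$, $C(e,\mathbf x)=c(e,\mathbf x_{\mathbb B(r)})$ depends only on $\mathbf x_{\mathbb B(r)}$; every cocycle is so for some $r$. For a trail $\zeta=(z_0,\dots,z_N)$ (consecutive points differ by unit steps) in $\mathbb G_r(\mathbf a)$ put $$c(\zeta,\mathbf a)=c(z_N-z_{N-1},\mathbf a_{\mathbb B(z_{N-1},r)})\cdots c(z_1-z_0,\mathbf a_{\mathbb B(z_0,r)}).$$ Let $\pi_1(\mathbb Y,y)$ be the set of closed trails in $\mathbb Y$ based at $y$ modulo trail homotopy in $\mathbb Y$ (generated by changing the middle vertex of two consecutive steps and by deleting or inserting back-and-forth steps). For $s>r$, $\zeta\mapsto c(\zeta,\mathbf a)$ induces the residue $\mathrm{Res}^s_{\mathbf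 a}C:\pi_1(\mathbb G_s(\mathbf a),y)\to G$. A proper base ray for $\mathbf a$ is an infinite trail $\omega$ tending to infinity which for every $s$ is eventually contained in $\mathbb G_s(\mathbf a)$. Let $\pi_1(\mathbb G_\infty(\mathbf a),\omega)=\varprojlim_s\pi_1(\mathbb G_s(\mathbf a),\omega)$, base points being moved along $\omega$. For $\zeta$ in it let $\mathrm{res}_{\mathbf a}(C,\zeta)$ be $c(\zeta',\mathbf a)$, where $C$ is locally determined with radius $r$ and $\zeta'$ represents $\zeta$ in $\mathbb G_s(\mathbf a)$ for some $s>r$ (well defined if $G$ is abelian, and up to conjugacy in general). We say that $\mathbf a$ has a $G$-pole (along $\omega$) if $\mathrm{res}_{\mathbf a}(C,\zeta)\ne e$ for some $G$-valued cocycle $C$ and some $\zeta$. A $G$-valued cocycle $C^*$ is fundamental if for every group $H$ and every $H$-valued cocycle $C$ there is a homomorphism $\psi:G\to H$ with $C\approx\psi\circ C^*$. **Proposition.** Let $\Phi$ be a cellular automaton on $\mathcal A^{\mathbb Z^D}$ of radius $R>0$ with $\Phi(\mathfrak A)\subseteq\mathfrak A$. Put $\Phi_*C(z,\mathbf x)=C(z,\Phi(\mathbf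 x))$. Let $\mathbf a\in\widetilde{\mathfrak A}$ and $\mathbf b=\Phi(\mathbf a)$. (a) Let $C$ be a cocycle (with values in any group) which is locally determined with radius $r>0$. Then $\mathbb G_{R+r}(\mathbf a)\subseteq\mathbb G_r(\mathbf b)$, $\Phi_*C$ is locally determined with radius $R+r$, and $C(\zeta,\mathbf b)=\Phi_*C(\zeta,\mathbf a)$ for every trail $\zeta$ in $\mathbb G_{R+r}(\mathbf a)$ (evaluated with local rules of radius $r$ and $R+r$ respectively). Consequently, for all $s>r$, $\mathrm{Res}_{\mathbf b}^{s}C\circ\iota=\mathrm{Res}_{\mathbf a}^{R+s}(\Phi_*C)$, where $\iota:\pi_1(\mathbb G_{R+s}(\mathbf a),y)\to\pi_1(\mathbb G_s(\mathbf b),y)$ is induced by inclusion. (b) If $\Phi_*:H^1_{dy}(\mathfrak A,G)\to H^1_{dy}(\mathfrak A,G)$ is surjective, then every $G$-pole is $\Phi$-persistent: if $\mathbf a$ has a $G$-pole along $\omega$, then for all $t\in\mathbb N$, $\Phi^t(\mathbf a)$ is defective and has a $G$-pole along $\omega$. Suppose $\mathfrak A$ has a fundamental cocycle $C^*$ with values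 in an abelian group $G^*$, and let $\mathrm{res}^*_{\mathbf a}(\zeta)=\mathrm{res}_{\mathbf a}(C^*,\zeta)$, $\zeta\in\pi_1(\mathbb G_\infty(\mathbf a),\omega)$. (c) If $H$ is any abelian group and $\mathbf a$ has an $H$-pole along $\omega$, then $\mathrm{res}^*_{\mathbf a}$ is nontrivial on $\pi_1(\mathbb G_\infty(\mathbf a),\omega)$. (d) There are $\varphi\in\mathrm{End}(G^*)$ with $\Phi_*(\varepsilon\circ C^*)\approx\varepsilon\circ\varphi\circ C^*$ for all $\varepsilon\in\mathrm{End}(G^*)$. For any such $\varphi$ and any proper base ray $\omega$ for $\mathbf a$ (which is then one for $\mathbf b$), $\mathrm{res}^*_{\mathbf b}\circ\iota=\varphi\circ\mathrm{res}^*_{\mathbf a}$, where $\iota:\pi_1(\mathbb G_\infty(\mathbf a),\omega)\to\pi_1(\mathbb G_\infty(\mathbf b),\omega)$ is induced by the inclusions $\mathbb G_{R+s}(\mathbf a)\subseteq\mathbb G_s(\mathbf b)$. Hence, if $\varphi^n\circ\mathrm{res}^*_{\mathbf a}$ is nontrivial for all $n\in\mathbb N$, then the defect of $\mathbf a$ is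 $\Phi$-persistent, i.e. $\Phi^t(\mathbf a)$ is defective for all $t\in\mathbb N$. (e) If such a $\varphi$ is a monomorphism, then every pole is $\Phi$-persistent: if $\mathbf a$ has an $H$-pole along $\omega$ for some group $H$, then for all $t\in\mathbb N$, $\Phi^t(\mathbf a)$ is defective and has a $G^*$-pole along $\omega$. -/

import Mathlib

universe u v

/-! ### Configurations, subshifts, cellular automata -/

/-- Configurations `a = [a_z]` on the lattice `ℤ^D` with letters in `A`. -/
abbrev Config (D : ℕ) (A : Type*) : Type _ := (Fin D → ℤ) → A

/-- The shift `σ^v`, `σ^v(a)_z = a_{z+v}`. -/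
def shift {D : ℕ} {A : Type*} (v : Fin D → ℤ) (a : Config D A) : Config D A := fun z => a (z + v)

/-- The box `𝔹(r) = [-r..r]^D`. -/
def box (D r : ℕ) : Set (Fin D → ℤ) := {i | ∀ k, |i k| ≤ (r : ℤ)}

theorem box_mono {D r s : ℕ} (h : r ≤ s) : box D r ⊆ box D s := fun i hi k =>
  (hi k).trans (by exact_mod_cast h)

/-- The set `𝔼` of unit steps `(0,…,0,±1,0,…,0)`. -/
def unitSteps (D : ℕ) : Set (Fin D → ℤ) := {e | ∃ k, e = Pi.single k 1 ∨ e = -Pi.single k 1}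

theorem unitSteps_neg {D : ℕ} {e : Fin D → ℤ} (he : e ∈ unitSteps D) : -e ∈ unitSteps D := by
  obtain ⟨k, rfl | rfl⟩ := he
  · exact ⟨k, Or.inr rfl⟩
  · exact ⟨k, Or.inl (neg_neg _)⟩

theorem unitSteps_box {D : ℕ} {e : Fin D → ℤ} (he : e ∈ unitSteps D) : e ∈ box D 1 := by
  obtain ⟨k, rfl | rfl⟩ := he <;> intro j <;> by_cases h : j = k <;> simp [h]

theorem box_add {D r s : ℕ} {i j : Fin D → ℤ} (hi : i ∈ box D r) (hj : j ∈ box D s) :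
    i + j ∈ box D (r + s) := fun k => by
  have h1 := hi k
  have h2 := hj k
  have h3 := abs_add_le (i k) (j k)
  push_cast
  simp only [Pi.add_apply]
  linarith

theorem unitSteps_finite (D : ℕ) : (unitSteps D).Finite := by
  have h : unitSteps D ⊆ Set.range (fun k : Fin D => (Pi.single k 1 : Fin D → ℤ)) ∪
      Set.range (fun k : Fin D => -(Pi.single k 1 : Fin D → ℤ)) := by
    rintro e ⟨k, rfl | rfl⟩
    · exact Or.inl ⟨k, rfl⟩
    · exact Or.inr ⟨k, rfl⟩
  exact ((Set.finite_range _).union (Set.finite_range _)).subset h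

/-- A subshift: a closed, shift-invariant set of configurations. -/
structure Subshift (D : ℕ) (A : Type*) [TopologicalSpace A] where
  carrier : Set (Config D A)
  isClosed : IsClosed carrier
  shift_mem : ∀ (v : Fin D → ℤ) (a : Config D A), a ∈ carrier → shift v a ∈ carrier

/-- A cellular automaton: a continuous self-map of `A^(ℤ^D)` commuting with all shifts. -/
structure CellularAutomaton (D : ℕ) (A : Type*) [TopologicalSpace A] where
  toFun : Config D A → Config D A
  continuous : Continuous toFun
  comm_shift : ∀ (v : Fin D → ℤ) (a : Config D A), toFun (shift v a) = shift v (toFun a)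

/-- `Φ` has radius `R`: the letter `Φ(a)_0` depends only on the block `a_{𝔹(R)}`. -/
def CellularAutomaton.HasRadius {D : ℕ} {A : Type*} [TopologicalSpace A]
    (Φ : CellularAutomaton D A) (R : ℕ) : Prop :=
  ∀ a a' : Config D A, (∀ i ∈ box D R, a i = a' i) → Φ.toFun a 0 = Φ.toFun a' 0

theorem CellularAutomaton.HasRadius.apply {D : ℕ} {A : Type*} [TopologicalSpace A]
    {Φ : CellularAutomaton D A} {R : ℕ} (h : Φ.HasRadius R) {a a' : Config D A} {z : Fin D → ℤ}
    (haa : ∀ i ∈ box D R, a (i + z) = a' (i + z)) : Φ.toFun a z = Φ.toFun a' z := by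
  have h1 := h (shift z a) (shift z a') haa
  rw [Φ.comm_shift, Φ.comm_shift] at h1
  simpa [shift] using h1

/-- `𝔄` is (weakly) `Φ`-invariant: `Φ(𝔄) ⊆ 𝔄`. -/
def Subshift.IsInvariant {D : ℕ} {A : Type*} [TopologicalSpace A] (𝔄 : Subshift D A)
    (Φ : CellularAutomaton D A) : Prop :=
  ∀ a ∈ 𝔄.carrier, Φ.toFun a ∈ 𝔄.carrier

/-! ### Admissible blocks and the defect field -/

/-- The block `a_{𝔹(z,r)}` is `𝔄`-admissible, i.e. belongs to `𝔄_(r)` (as a block on `𝔹(r)`). -/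
def Subshift.Admissible {D : ℕ} {A : Type*} [TopologicalSpace A] (𝔄 : Subshift D A)
    (a : Config D A) (z : Fin D → ℤ) (r : ℕ) : Prop :=
  ∃ x ∈ 𝔄.carrier, ∀ i ∈ box D r, x i = a (i + z)

/-- The defect field: the largest `r` (possibly `∞`) such that `a_{𝔹(z,r)}` is admissible. -/
noncomputable def Subshift.defectField {D : ℕ} {A : Type*} [TopologicalSpace A]
    (𝔄 : Subshift D A) (a : Config D A) (z : Fin D → ℤ) : ℕ∞ :=
  ⨆ (r : ℕ) (_ : 𝔄.Admissible a z r), (r : ℕ∞)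

/-- The unflawed region `𝔾_r(a)` of range `r`: the sites where the defect field is at least `r`. -/
def Subshift.unflawed {D : ℕ} {A : Type*} [TopologicalSpace A] (𝔄 : Subshift D A)
    (a : Config D A) (r : ℕ) : Set (Fin D → ℤ) :=
  {z | (r : ℕ∞) ≤ 𝔄.defectField a z}

/-- The set `𝔄~` of configurations whose defect field is unbounded. -/
def Subshift.slightlyDefective {D : ℕ} {A : Type*} [TopologicalSpace A] (𝔄 : Subshift D A) :
    Set (Config D A) :=
  {a | ⨆ z, 𝔄.defectField a z = ⊤}

/-- `a` is defective: it lies in `𝔄~` but not in `𝔄`. -/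
def Subshift.IsDefective {D : ℕ} {A : Type*} [TopologicalSpace A] (𝔄 : Subshift D A)
    (a : Config D A) : Prop :=
  a ∈ 𝔄.slightlyDefective ∧ a ∉ 𝔄.carrier

section
variable {D : ℕ} {A : Type*} [TopologicalSpace A] (𝔄 : Subshift D A)

theorem Subshift.Admissible.anti {𝔄 : Subshift D A} {a : Config D A} {z : Fin D → ℤ} {r s : ℕ}
    (hrs : r ≤ s) (h : 𝔄.Admissible a z s) : 𝔄.Admissible a z r := by
  obtain ⟨x, hx, hxa⟩ := h
  exact ⟨x, hx, fun i hi => hxa i (box_mono hrs hi)⟩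

theorem Subshift.mem_unflawed_iff {a : Config D A} {z : Fin D → ℤ} {r : ℕ} (hr : 0 < r) :
    z ∈ 𝔄.unflawed a r ↔ 𝔄.Admissible a z r := by
  constructor
  · intro h
    by_contra hn
    have h1 : 𝔄.defectField a z ≤ ((r - 1 : ℕ) : ℕ∞) := by
      unfold Subshift.defectField
      refine iSup₂_le fun s hs => ?_
      have : s < r := by
        by_contra hsr
        exact hn (hs.anti (not_lt.mp hsr))
      exact_mod_cast (by omega : s ≤ r - 1)
    have h2 : (r : ℕ∞) ≤ ((r - 1 : ℕ) : ℕ∞) := le_trans h h1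
    have h3 : r ≤ r - 1 := by exact_mod_cast h2
    omega
  · intro h
    exact le_iSup₂ (f := fun (r : ℕ) (_ : 𝔄.Admissible a z r) => (r : ℕ∞)) r h

theorem Subshift.unflawed_anti (a : Config D A) {r s : ℕ} (h : r ≤ s) :
    𝔄.unflawed a s ⊆ 𝔄.unflawed a r := fun _ hz =>
  by
  have h1 : (r : ℕ∞) ≤ (s : ℕ∞) := by exact_mod_cast h
  exact h1.trans hz

variable {𝔄} in
/-- A cellular automaton of radius `R` shrinks the unflawed regions by at most `R`. -/
theorem Subshift.unflawed_subset {Φ : CellularAutomaton D A} {R : ℕ} (hR : Φ.HasRadius R)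
    (hΦ : 𝔄.IsInvariant Φ) (a : Config D A) (s : ℕ) :
    𝔄.unflawed a (R + s) ⊆ 𝔄.unflawed (Φ.toFun a) s := by
  intro z hz
  rcases Nat.eq_zero_or_pos s with rfl | hs
  · simp [Subshift.unflawed]
  rw [Subshift.mem_unflawed_iff _ (by omega)] at hz ⊢
  obtain ⟨x, hx, hxa⟩ := hz
  refine ⟨Φ.toFun x, hΦ x hx, fun i hi => ?_⟩
  have h1 : Φ.toFun x i = Φ.toFun (shift z a) i :=
    hR.apply fun j hj => hxa (j + i) (box_add hj hi)
  rw [h1, Φ.comm_shift]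
  rfl

end

/-! ### Dynamical cocycles -/

/-- The shift as a self-map of a subshift. -/
def Subshift.shiftMap {D : ℕ} {A : Type*} [TopologicalSpace A] (𝔄 : Subshift D A)
    (v : Fin D → ℤ) (a : 𝔄.carrier) : 𝔄.carrier :=
  ⟨shift v a.1, 𝔄.shift_mem v a.1 a.2⟩

/-- A continuous dynamical cocycle on `𝔄` with values in the discrete group `G`
(continuity into a discrete space is local constancy). -/
@[ext]
structure Cocycle {D : ℕ} {A : Type*} [TopologicalSpace A] (𝔄 : Subshift D A)
    (G : Type*) [Group G] where
  toFun : (Fin D → ℤ) → 𝔄.carrier → G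
  locConst : ∀ z, IsLocallyConstant (toFun z)
  cocycle_eq : ∀ (y z : Fin D → ℤ) (a : 𝔄.carrier),
    toFun (y + z) a = toFun y (𝔄.shiftMap z a) * toFun z a

/-- `C ≈ C'`: there is a continuous transfer function `b` with
`C'(z,a) = b(σ^z a) C(z,a) b(a)⁻¹`. -/
def Cocycle.Cohomologous {D : ℕ} {A : Type*} [TopologicalSpace A] {𝔄 : Subshift D A}
    {G : Type*} [Group G] (C C' : Cocycle 𝔄 G) : Prop :=
  ∃ b : 𝔄.carrier → G, IsLocallyConstant b ∧
    ∀ (z : Fin D → ℤ) (a : 𝔄.carrier), C'.toFun z a = b (𝔄.shiftMap z a) * C.toFun z a * (b a)⁻¹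

/-- `C` is locally determined with radius `r`: for every unit step `e`, `C(e,a)` is a function of
the block `a_{𝔹(r)}`. -/
def Cocycle.IsLocallyDetermined {D : ℕ} {A : Type*} [TopologicalSpace A] {𝔄 : Subshift D A}
    {G : Type*} [Group G] (C : Cocycle 𝔄 G) (r : ℕ) : Prop :=
  ∀ e ∈ unitSteps D, ∀ a a' : 𝔄.carrier, (∀ i ∈ box D r, a.1 i = a'.1 i) →
    C.toFun e a = C.toFun e a'

open Classical in
/-- The value `c(e, a_{𝔹(z,r)})` of the local rule of `C` of radius `r` at the block of `a` around
`z`: it is `C(e,x)` for any `x ∈ 𝔄` whose block on `𝔹(r)` is that block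
(and the junk value `1` if the block is not admissible). -/
noncomputable def Cocycle.localRule {D : ℕ} {A : Type*} [TopologicalSpace A] {𝔄 : Subshift D A}
    {G : Type*} [Group G] (C : Cocycle 𝔄 G) (r : ℕ) (e : Fin D → ℤ) (a : Config D A)
    (z : Fin D → ℤ) : G :=
  if h : 𝔄.Admissible a z r then C.toFun e ⟨h.choose, h.choose_spec.1⟩ else 1

section
variable {D : ℕ} {A : Type*} [TopologicalSpace A] {𝔄 : Subshift D A} {G H : Type*} [Group G]
  [Group H]

theorem Cocycle.localRule_eq {C : Cocycle 𝔄 G} {r : ℕ} (hC : C.IsLocallyDetermined r)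
    {e : Fin D → ℤ} (he : e ∈ unitSteps D) {a : Config D A} {z : Fin D → ℤ} (x : 𝔄.carrier)
    (hx : ∀ i ∈ box D r, x.1 i = a (i + z)) : C.localRule r e a z = C.toFun e x := by
  have h : 𝔄.Admissible a z r := ⟨x.1, x.2, hx⟩
  rw [Cocycle.localRule, dif_pos h]
  exact hC e he _ _ fun i hi => (h.choose_spec.2 i hi).trans (hx i hi).symm

theorem Subshift.continuous_shiftMap (v : Fin D → ℤ) : Continuous (𝔄.shiftMap v) := by
  refine Continuous.subtype_mk (continuous_pi fun z => ?_) _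
  exact (continuous_apply (z + v)).comp continuous_subtype_val

theorem Cocycle.map_zero (C : Cocycle 𝔄 G) (a : 𝔄.carrier) : C.toFun 0 a = 1 := by
  have h := C.cocycle_eq 0 0 a
  have h0 : 𝔄.shiftMap 0 a = a := by
    apply Subtype.ext
    funext z
    simp [Subshift.shiftMap, shift]
  rw [h0, add_zero] at h
  simpa using h

/-- Every continuous cocycle with values in a discrete group is locally determined. -/
theorem Cocycle.exists_isLocallyDetermined [DiscreteTopology A] [Finite A] (C : Cocycle 𝔄 G) :
    ∃ r, C.IsLocallyDetermined r := by
  have : CompactSpace 𝔄.carrier := isCompact_iff_compactSpace.mp 𝔄.isClosed.isCompact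
  have key : ∀ e : Fin D → ℤ, ∃ r : ℕ, ∀ a a' : 𝔄.carrier,
      (∀ i ∈ box D r, a.1 i = a'.1 i) → C.toFun e a = C.toFun e a' := by
    intro e
    let K : Set (𝔄.carrier × 𝔄.carrier) := {p | C.toFun e p.1 ≠ C.toFun e p.2}
    let S : ℕ → Set (𝔄.carrier × 𝔄.carrier) := fun r => {p | ∀ i ∈ box D r, p.1.1 i = p.2.1 i}
    have hK : IsCompact K := by
      apply IsClosed.isCompact
      have h1 : IsLocallyConstant (fun p : 𝔄.carrier × 𝔄.carrier =>
          (C.toFun e p.1, C.toFun e p.2)) :=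
        ((C.locConst e).comp_continuous continuous_fst).prodMk
          ((C.locConst e).comp_continuous continuous_snd)
      exact ⟨h1 {q | ¬ q.1 ≠ q.2}⟩
    have hS : ∀ r, IsClosed (S r) := by
      intro r
      simp only [S, Set.ofPred_forall]
      refine isClosed_iInter fun i => isClosed_iInter fun _ => ?_
      exact isClosed_eq
        ((continuous_apply i).comp (continuous_subtype_val.comp continuous_fst))
        ((continuous_apply i).comp (continuous_subtype_val.comp continuous_snd))
    have hdir : Directed (· ⊇ ·) S := by
      intro r s
      refine ⟨max r s, fun p hp i hi => hp i (box_mono (le_max_left _ _) hi),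
        fun p hp i hi => hp i (box_mono (le_max_right _ _) hi)⟩
    have hemp : K ∩ ⋂ r, S r = ∅ := by
      ext p
      simp only [Set.mem_inter_iff, Set.mem_iInter, Set.mem_empty_iff_false, iff_false, not_and]
      intro hp hall
      apply hp
      have : p.1 = p.2 := by
        apply Subtype.ext
        funext i
        refine hall (∑ k, (i k).natAbs) i fun k => ?_
        have h1 : (i k).natAbs ≤ ∑ k, (i k).natAbs :=
          Finset.single_le_sum (f := fun k => (i k).natAbs) (fun _ _ => Nat.zero_le _)
            (Finset.mem_univ k)
        rw [Int.abs_eq_natAbs]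
        exact_mod_cast h1
      rw [this]
    obtain ⟨r, hr⟩ := hK.elim_directed_family_closed S hS hemp hdir
    refine ⟨r, fun a a' haa => ?_⟩
    by_contra hne
    have : (a, a') ∈ K ∩ S r := ⟨hne, haa⟩
    rw [hr] at this
    exact this
  choose f hf using key
  obtain ⟨M, hM⟩ := ((unitSteps_finite D).image f).bddAbove
  exact ⟨M, fun e he a a' haa =>
    hf e a a' fun i hi => haa i (box_mono (hM ⟨e, he, rfl⟩) hi)⟩

/-- The induced cocycle `Φ_* C (z,a) = C(z, Φ(a))`. -/
def Cocycle.pullback {Φ : CellularAutomaton D A} (hΦ : 𝔄.IsInvariant Φ) (C : Cocycle 𝔄 G) :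
    Cocycle 𝔄 G where
  toFun z a := C.toFun z ⟨Φ.toFun a.1, hΦ a.1 a.2⟩
  locConst z := (C.locConst z).comp_continuous
    (Continuous.subtype_mk (Φ.continuous.comp continuous_subtype_val) _)
  cocycle_eq y z a := by
    rw [C.cocycle_eq]
    congr 2
    apply Subtype.ext
    exact (Φ.comm_shift z a.1).symm

/-- The cocycle `ψ ∘ C` for a group homomorphism `ψ`. -/
def Cocycle.comp (ψ : G →* H) (C : Cocycle 𝔄 G) : Cocycle 𝔄 H where
  toFun z a := ψ (C.toFun z a)
  locConst z := (C.locConst z).comp ψ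
  cocycle_eq y z a := by rw [C.cocycle_eq, map_mul]

/-- The cocycle `C(z,a) = h(z)` of a group homomorphism `h : ℤ^D → G`. -/
def Cocycle.ofHom (𝔄 : Subshift D A) (h : Multiplicative (Fin D → ℤ) →* G) : Cocycle 𝔄 G where
  toFun z _ := h (Multiplicative.ofAdd z)
  locConst _ := IsLocallyConstant.const _
  cocycle_eq y z _ := by rw [ofAdd_add, map_mul]

/-- A cocycle is trivial if it is cohomologous to a homomorphism. -/
def Cocycle.IsTrivial (C : Cocycle 𝔄 G) : Prop :=
  ∃ h : Multiplicative (Fin D → ℤ) →* G, C.Cohomologous (Cocycle.ofHom 𝔄 h)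

theorem Cocycle.Cohomologous.refl (C : Cocycle 𝔄 G) : C.Cohomologous C :=
  ⟨fun _ => 1, IsLocallyConstant.const _, fun z a => by simp⟩

theorem Cocycle.Cohomologous.symm {C C' : Cocycle 𝔄 G} (h : C.Cohomologous C') :
    C'.Cohomologous C := by
  obtain ⟨b, hb, h⟩ := h
  exact ⟨fun a => (b a)⁻¹, hb.comp _, fun z a => by rw [h]; group⟩

theorem Cocycle.Cohomologous.trans {C C' C'' : Cocycle 𝔄 G} (h : C.Cohomologous C')
    (h' : C'.Cohomologous C'') : C.Cohomologous C'' := by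
  obtain ⟨b, hb, h⟩ := h
  obtain ⟨b', hb', h'⟩ := h'
  exact ⟨fun a => b' a * b a, hb'.comp₂ hb _, fun z a => by rw [h', h]; group⟩

theorem Cocycle.Cohomologous.pullback {Φ : CellularAutomaton D A} (hΦ : 𝔄.IsInvariant Φ)
    {C C' : Cocycle 𝔄 G} (h : C.Cohomologous C') :
    (C.pullback hΦ).Cohomologous (C'.pullback hΦ) := by
  obtain ⟨b, hb, h⟩ := h
  refine ⟨fun a => b ⟨Φ.toFun a.1, hΦ a.1 a.2⟩, hb.comp_continuous
    (Continuous.subtype_mk (Φ.continuous.comp continuous_subtype_val) _), fun z a => ?_⟩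
  have h1 : 𝔄.shiftMap z ⟨Φ.toFun a.1, hΦ a.1 a.2⟩ =
      ⟨Φ.toFun (𝔄.shiftMap z a).1, hΦ _ (𝔄.shiftMap z a).2⟩ :=
    Subtype.ext (Φ.comm_shift z a.1).symm
  have h2 := h z ⟨Φ.toFun a.1, hΦ a.1 a.2⟩
  rw [h1] at h2
  exact h2

/-- Cohomology of cocycles is an equivalence relation. -/
instance Cocycle.cohomologousSetoid (𝔄 : Subshift D A) (G : Type*) [Group G] :
    Setoid (Cocycle 𝔄 G) :=
  ⟨Cocycle.Cohomologous, Cocycle.Cohomologous.refl, Cocycle.Cohomologous.symm,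
    Cocycle.Cohomologous.trans⟩

/-- For a group `G` that need not be abelian: the set of cohomology classes of cocycles. -/
def DynClasses (𝔄 : Subshift D A) (G : Type*) [Group G] : Type _ :=
  Quotient (Cocycle.cohomologousSetoid 𝔄 G)

/-- The map induced by `Φ` on the set of cohomology classes. -/
def DynClasses.map {Φ : CellularAutomaton D A} (hΦ : 𝔄.IsInvariant Φ) (G : Type*) [Group G] :
    DynClasses 𝔄 G → DynClasses 𝔄 G :=
  Quotient.map (Cocycle.pullback hΦ) fun _ _ h => Cocycle.Cohomologous.pullback hΦ h

end

/-! ### The cohomology group for abelian coefficients -/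

section
variable {D : ℕ} {A : Type*} [TopologicalSpace A] (𝔄 : Subshift D A) (G : Type*) [CommGroup G]

/-- Cocycles with values in an abelian group form a group under pointwise multiplication. -/
instance Cocycle.instCommGroup : CommGroup (Cocycle 𝔄 G) where
  mul C C' := ⟨fun z a => C.toFun z a * C'.toFun z a,
    fun z => (C.locConst z).comp₂ (C'.locConst z) (· * ·),
    fun y z a => by rw [C.cocycle_eq, C'.cocycle_eq, mul_mul_mul_comm]⟩
  one := ⟨fun _ _ => 1, fun _ => IsLocallyConstant.const _, fun _ _ _ => (mul_one 1).symm⟩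
  inv C := ⟨fun z a => (C.toFun z a)⁻¹, fun z => (C.locConst z).comp (·⁻¹),
    fun y z a => by rw [C.cocycle_eq, mul_inv]⟩
  mul_assoc _ _ _ := Cocycle.ext (funext₂ fun _ _ => mul_assoc _ _ _)
  one_mul _ := Cocycle.ext (funext₂ fun _ _ => one_mul _)
  mul_one _ := Cocycle.ext (funext₂ fun _ _ => mul_one _)
  inv_mul_cancel _ := Cocycle.ext (funext₂ fun _ _ => inv_mul_cancel _)
  mul_comm _ _ := Cocycle.ext (funext₂ fun _ _ => mul_comm _ _)

/-- The subgroup of trivial cocycles (those cohomologous to a homomorphism). -/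
def trivialCocycles : Subgroup (Cocycle 𝔄 G) where
  carrier := {C | C.IsTrivial}
  one_mem' := ⟨1, fun _ => 1, IsLocallyConstant.const _, fun z a => by
    change _ = 1 * (1 : G) * 1⁻¹
    simp [Cocycle.ofHom]⟩
  mul_mem' := by
    rintro C C' ⟨h, b, hb, e⟩ ⟨h', b', hb', e'⟩
    refine ⟨h * h', fun a => b a * b' a, hb.comp₂ hb' (· * ·), fun z a => ?_⟩
    have e1 := congrArg₂ (· * ·) (e z a) (e' z a)
    change h _ * h' _ = _ at e1
    change h _ * h' _ = _ * (C.toFun z a * C'.toFun z a) * _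
    rw [e1, mul_inv]
    simp only [mul_comm, mul_left_comm, mul_assoc]
  inv_mem' := by
    rintro C ⟨h, b, hb, e⟩
    refine ⟨h⁻¹, fun a => (b a)⁻¹, hb.comp (·⁻¹), fun z a => ?_⟩
    have e1 := congrArg (·⁻¹) (e z a)
    change (h _)⁻¹ = _ at e1
    change (h _)⁻¹ = _ * (C.toFun z a)⁻¹ * _
    rw [e1]
    simp only [mul_inv, inv_inv]

/-- The first dynamical cohomology group of `𝔄` with coefficients in the abelian group `G`:
cocycles modulo trivial cocycles. -/
abbrev DynCohomology : Type _ := Cocycle 𝔄 G ⧸ trivialCocycles 𝔄 G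

variable {𝔄}

/-- `Φ_*` as an endomorphism of the group of cocycles. -/
def Cocycle.pullbackHom {Φ : CellularAutomaton D A} (hΦ : 𝔄.IsInvariant Φ) :
    Cocycle 𝔄 G →* Cocycle 𝔄 G where
  toFun := Cocycle.pullback hΦ
  map_one' := rfl
  map_mul' _ _ := rfl

/-- The endomorphism `Φ_*` of the first dynamical cohomology group. -/
def DynCohomology.map {Φ : CellularAutomaton D A} (hΦ : 𝔄.IsInvariant Φ) :
    DynCohomology 𝔄 G →* DynCohomology 𝔄 G :=
  QuotientGroup.map _ _ (Cocycle.pullbackHom G hΦ) fun _ hC =>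
    let ⟨h, hC⟩ := hC
    ⟨h, Cocycle.Cohomologous.pullback hΦ hC⟩

end

/-- A cocycle with values in `G` is fundamental if every cocycle with values in any group `H` is
cohomologous to its image under some homomorphism `G → H`. -/
def Cocycle.IsFundamental {D : ℕ} {A : Type*} [TopologicalSpace A] {𝔄 : Subshift D A}
    {G : Type u} [Group G] (Cs : Cocycle 𝔄 G) : Prop :=
  ∀ (H : Type u) [Group H] (C : Cocycle 𝔄 H), ∃ ψ : G →* H, C.Cohomologous (Cs.comp ψ)

/-- `φ ∈ End(G)` is an endomorphism induced by `Φ` through the cocycle `Cs`: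
`Φ_*(ε ∘ Cs) ≈ (ε ∘ φ) ∘ Cs` for all `ε ∈ End(G)`. -/
def Cocycle.IsInducedEnd {D : ℕ} {A : Type*} [TopologicalSpace A] {𝔄 : Subshift D A}
    {Φ : CellularAutomaton D A} (hΦ : 𝔄.IsInvariant Φ) {G : Type*} [CommGroup G]
    (Cs : Cocycle 𝔄 G) (φ : G →* G) : Prop :=
  ∀ ε : G →* G, ((Cs.comp ε).pullback hΦ).Cohomologous (Cs.comp (ε.comp φ))

/-! ### Trails, trail homotopy and the fundamental group -/

/-- The nearest neighbour graph on `ℤ^D`. -/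
def latticeGraph (D : ℕ) : SimpleGraph (Fin D → ℤ) where
  Adj x y := y - x ∈ unitSteps D
  symm := ⟨fun x y h => by simpa using unitSteps_neg h⟩
  loopless := ⟨fun x h => by
    rw [sub_self] at h
    obtain ⟨k, hk | hk⟩ := h
    · simpa using congrFun hk k
    · simpa using congrFun hk k⟩

/-- A trail in `Y ⊆ ℤ^D` from `x` to `y`: a walk all of whose vertices lie in `Y`. -/
abbrev Trail {D : ℕ} (Y : Set (Fin D → ℤ)) (x y : Y) : Type :=
  ((latticeGraph D).induce Y).Walk x y

/-- Elementary homotopies of trails in `Y` (endpoints fixed): replace the middle vertex of two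
consecutive steps, or remove a back-and-forth pair of steps. -/
inductive ElemHomotopic {D : ℕ} {Y : Set (Fin D → ℤ)} :
    ∀ {x y : Y}, Trail Y x y → Trail Y x y → Prop
  | square {x u v v' w y : Y} (p : Trail Y x u)
      (h1 : ((latticeGraph D).induce Y).Adj u v) (h2 : ((latticeGraph D).induce Y).Adj v w)
      (h1' : ((latticeGraph D).induce Y).Adj u v') (h2' : ((latticeGraph D).induce Y).Adj v' w)
      (q : Trail Y w y) :
      ElemHomotopic (p.append (.cons h1 (.cons h2 q))) (p.append (.cons h1' (.cons h2' q)))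
  | spur {x u v y : Y} (p : Trail Y x u)
      (h1 : ((latticeGraph D).induce Y).Adj u v) (h2 : ((latticeGraph D).induce Y).Adj v u)
      (q : Trail Y u y) :
      ElemHomotopic (p.append (.cons h1 (.cons h2 q))) (p.append q)

/-- Homotopy of trails in `Y`: the equivalence relation generated by elementary homotopies. -/
def trailSetoid {D : ℕ} (Y : Set (Fin D → ℤ)) (x y : Y) : Setoid (Trail Y x y) :=
  Relation.EqvGen.setoid ElemHomotopic

/-- (The underlying set of) the fundamental group `π₁(Y,x)`: homotopy classes of closed trails
in `Y` based at `x`. -/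
def LoopClass {D : ℕ} (Y : Set (Fin D → ℤ)) (x : Y) : Type := Quotient (trailSetoid Y x x)

/-- A trail in `Y` seen as a trail in a larger set. -/
def Trail.incl {D : ℕ} {Y Z : Set (Fin D → ℤ)} (h : Y ⊆ Z) {x y : Y} (p : Trail Y x y) :
    Trail Z ⟨x.1, h x.2⟩ ⟨y.1, h y.2⟩ :=
  SimpleGraph.Walk.map ⟨fun z : Y => (⟨z.1, h z.2⟩ : Z), fun hadj => hadj⟩ p

theorem ElemHomotopic.conj {D : ℕ} {Y Z : Set (Fin D → ℤ)} (h : Y ⊆ Z) {x y : Y}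
    {p p' : Trail Y x y} (hp : ElemHomotopic p p') {x' y' : Z} (q : Trail Z x' ⟨x.1, h x.2⟩)
    {q' : Trail Z ⟨y.1, h y.2⟩ y'} :
    ElemHomotopic (q.append ((Trail.incl h p).append q')) (q.append ((Trail.incl h p').append q')) := by
  cases hp with
  | @square u v v' w _ p h1 h2 h1' h2' r =>
    have := ElemHomotopic.square (q.append (Trail.incl h p)) (v := ⟨v.1, h v.2⟩)
      (v' := ⟨v'.1, h v'.2⟩) (w := ⟨w.1, h w.2⟩) h1 h2 h1' h2' ((Trail.incl h r).append q')
    simpa only [Trail.incl, SimpleGraph.Walk.map_append, SimpleGraph.Walk.map_cons,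
      ← SimpleGraph.Walk.append_assoc, SimpleGraph.Walk.cons_append] using this
  | @spur u v _ p h1 h2 r =>
    have := ElemHomotopic.spur (q.append (Trail.incl h p)) (u := ⟨u.1, h u.2⟩)
      (v := ⟨v.1, h v.2⟩) h1 h2 ((Trail.incl h r).append q')
    simpa only [Trail.incl, SimpleGraph.Walk.map_append, SimpleGraph.Walk.map_cons,
      ← SimpleGraph.Walk.append_assoc, SimpleGraph.Walk.cons_append] using this

/-- Given `Y ⊆ Z` and a trail `q` in `Z` from `x'` to the point `x` of `Y`: the map
`π₁(Y,x) → π₁(Z,x')`, `[p] ↦ [q ⋆ p ⋆ q⁻¹]`. -/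
def LoopClass.push {D : ℕ} {Y Z : Set (Fin D → ℤ)} (h : Y ⊆ Z) {x : Y} {x' : Z}
    (q : Trail Z x' ⟨x.1, h x.2⟩) : LoopClass Y x → LoopClass Z x' :=
  Quotient.map (sa := trailSetoid Y x x) (sb := trailSetoid Z x' x')
    (fun p => q.append ((Trail.incl h p).append q.reverse)) (by
      intro p p' hpp
      change Relation.EqvGen _ _ _ at hpp
      change Relation.EqvGen _ _ _
      induction hpp with
      | rel p p' hp => exact Relation.EqvGen.rel _ _ (hp.conj h q)
      | refl => exact Relation.EqvGen.refl _
      | symm _ _ _ ih => exact Relation.EqvGen.symm _ _ ih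
      | trans _ _ _ _ _ ih1 ih2 => exact Relation.EqvGen.trans _ _ _ ih1 ih2)

theorem LoopClass.push_push {D : ℕ} {X Y Z : Set (Fin D → ℤ)} (h : X ⊆ Y) (h' : Y ⊆ Z) {x : X}
    {x' : Y} {x'' : Z} (q : Trail Y x' ⟨x.1, h x.2⟩) (q' : Trail Z x'' ⟨x'.1, h' x'.2⟩)
    (ζ : LoopClass X x) : LoopClass.push h' q' (LoopClass.push h q ζ) =
      LoopClass.push (h.trans h') (q'.append (Trail.incl h' q)) ζ := by
  induction ζ using Quotient.inductionOn with
  | h p =>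
    refine congrArg (Quotient.mk (trailSetoid Z x'' x'')) ?_
    simp only [Trail.incl, SimpleGraph.Walk.map_append, SimpleGraph.Walk.map_map,
      ← SimpleGraph.Walk.append_assoc, SimpleGraph.Walk.reverse_append,
      SimpleGraph.Walk.reverse_map]
    erw [← SimpleGraph.Walk.append_assoc]
    rfl

/-- The map `π₁(Y,x) → π₁(Z,x)` induced by an inclusion `Y ⊆ Z`. -/
def LoopClass.incl {D : ℕ} {Y Z : Set (Fin D → ℤ)} (h : Y ⊆ Z) {x : Y} :
    LoopClass Y x → LoopClass Z ⟨x.1, h x.2⟩ :=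
  LoopClass.push h .nil

/-! ### Residues -/

section
variable {D : ℕ} {A : Type*} [TopologicalSpace A] {𝔄 : Subshift D A} {G : Type*} [Group G]

/-- The value `c(ζ,a) = c(z'_N, a_{𝔹(z_{N-1},r)}) ⋯ c(z'_2, a_{𝔹(z_1,r)}) · c(z'_1, a_{𝔹(z_0,r)})`
of the local rule of `C` of radius `r` along a trail `ζ = (z_0,…,z_N)`, where
`z'_n = z_n - z_{n-1}`. Later steps stand on the left, as the cocycle equation dictates. -/
noncomputable def Cocycle.along (C : Cocycle 𝔄 G) (r : ℕ) (a : Config D A)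
    {Y : Set (Fin D → ℤ)} : ∀ {x y : Y}, Trail Y x y → G
  | _, _, .nil => 1
  | x, _, .cons (v := v) _ p => Cocycle.along C r a p * C.localRule r (v.1 - x.1) a x.1

theorem Cocycle.along_append (C : Cocycle 𝔄 G) (r : ℕ) (a : Config D A) {Y : Set (Fin D → ℤ)}
    {x y z : Y} (p : Trail Y x y) (q : Trail Y y z) :
    C.along r a (p.append q) = C.along r a q * C.along r a p := by
  induction p with
  | nil => simp [Cocycle.along]
  | cons h p ih => simp [Cocycle.along, ih, mul_assoc]

/-- Two consecutive steps starting at a site of the unflawed region of range `s > r` have the value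
that the cocycle takes at an element of `𝔄`. -/
theorem Cocycle.localRule_two {C : Cocycle 𝔄 G} {r s : ℕ} (hC : C.IsLocallyDetermined r)
    (hs : r < s) {a : Config D A} {u v w : Fin D → ℤ} (h1 : v - u ∈ unitSteps D)
    (h2 : w - v ∈ unitSteps D) (x : 𝔄.carrier) (hx : ∀ i ∈ box D s, x.1 i = a (i + u)) :
    C.localRule r (w - v) a v * C.localRule r (v - u) a u = C.toFun (w - u) x := by
  have e1 : C.localRule r (v - u) a u = C.toFun (v - u) x :=
    Cocycle.localRule_eq hC h1 x fun i hi => hx i (box_mono hs.le hi)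
  have e2 : C.localRule r (w - v) a v = C.toFun (w - v) (𝔄.shiftMap (v - u) x) := by
    refine Cocycle.localRule_eq hC h2 _ fun i hi => ?_
    have := hx (i + (v - u)) (box_mono hs (box_add hi (unitSteps_box h1)))
    simpa [Subshift.shiftMap, shift, add_assoc] using this
  rw [e1, e2, ← C.cocycle_eq, sub_add_sub_cancel]

theorem Cocycle.along_elemHomotopic {C : Cocycle 𝔄 G} {r s : ℕ} (hC : C.IsLocallyDetermined r)
    (hs : r < s) {a : Config D A} {x y : 𝔄.unflawed a s} {p p' : Trail (𝔄.unflawed a s) x y}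
    (h : ElemHomotopic p p') : C.along r a p = C.along r a p' := by
  have adm : ∀ u : 𝔄.unflawed a s, ∃ x : 𝔄.carrier, ∀ i ∈ box D s, x.1 i = a (i + u.1) := by
    intro u
    obtain ⟨x, hx, hxa⟩ := (𝔄.mem_unflawed_iff (by omega)).mp u.2
    exact ⟨⟨x, hx⟩, hxa⟩
  cases h with
  | @square u v v' w _ p h1 h2 h1' h2' q =>
    obtain ⟨x, hx⟩ := adm u
    have e1 := Cocycle.localRule_two hC hs (u := u.1) (v := v.1) (w := w.1) h1 h2 x hx
    have e2 := Cocycle.localRule_two hC hs (u := u.1) (v := v'.1) (w := w.1) h1' h2' x hx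
    simp only [Cocycle.along_append, Cocycle.along, mul_assoc]
    rw [← mul_assoc (C.localRule r (w.1 - v.1) a v.1), ← mul_assoc (C.localRule r (w.1 - v'.1) a v'.1),
      e1, e2]
  | @spur u v _ p h1 h2 q =>
    obtain ⟨x, hx⟩ := adm u
    have e1 := Cocycle.localRule_two hC hs (u := u.1) (v := v.1) (w := u.1) h1 h2 x hx
    simp only [Cocycle.along_append, Cocycle.along, mul_assoc]
    rw [← mul_assoc (C.localRule r (u.1 - v.1) a v.1), e1, sub_self, Cocycle.map_zero, one_mul]

/-- The residue of range `s` of `a`: for a cocycle `C` which is locally determined with radius `r`,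
and `s > r`, the map `π₁(𝔾_s(a),x) → G` which sends the class of a closed trail `ζ` to `c(ζ,a)`. -/
noncomputable def Cocycle.residue (C : Cocycle 𝔄 G) {r : ℕ} (hC : C.IsLocallyDetermined r) {s : ℕ}
    (hs : r < s) (a : Config D A) {x : 𝔄.unflawed a s} : LoopClass (𝔄.unflawed a s) x → G :=
  Quotient.lift (s := trailSetoid _ x x) (C.along r a) (by
    intro p p' hpp
    change Relation.EqvGen _ _ _ at hpp
    induction hpp with
    | rel p p' h => exact Cocycle.along_elemHomotopic hC hs h
    | refl => rfl
    | symm _ _ _ ih => exact ih.symm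
    | trans _ _ _ _ _ ih1 ih2 => exact ih1.trans ih2)

end

/-! ### Proper base rays and the projective fundamental group -/

/-- The segment from index `n` to index `m` of an infinite trail `ω` which lies in `Y` from index
`n` on. -/
def raySegment {D : ℕ} {ω : ℕ → Fin D → ℤ} (hadj : ∀ n, (latticeGraph D).Adj (ω n) (ω (n + 1)))
    {Y : Set (Fin D → ℤ)} {n : ℕ} (hY : ∀ k ≥ n, ω k ∈ Y) {m : ℕ} (hm : n ≤ m) :
    Trail Y ⟨ω n, hY n le_rfl⟩ ⟨ω m, hY m hm⟩ :=
  Nat.leRec (motive := fun k hk => Trail Y ⟨ω n, hY n le_rfl⟩ ⟨ω k, hY k hk⟩)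
    .nil (fun k _ p => p.concat (hadj k)) hm

theorem raySegment_append {D : ℕ} {ω : ℕ → Fin D → ℤ}
    (hadj : ∀ n, (latticeGraph D).Adj (ω n) (ω (n + 1))) {Y Z : Set (Fin D → ℤ)} (h : Y ⊆ Z)
    {n m k : ℕ} (hZ : ∀ k ≥ n, ω k ∈ Z) (hY : ∀ k ≥ m, ω k ∈ Y) (hnm : n ≤ m) (hmk : m ≤ k) :
    (raySegment hadj hZ hnm).append (Trail.incl h (raySegment hadj hY hmk)) =
      raySegment hadj hZ (hnm.trans hmk) := by
  induction k, hmk using Nat.le_induction with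
  | base =>
    rw [raySegment.eq_def hadj hY, Nat.leRec_self]
    exact SimpleGraph.Walk.append_nil _
  | succ k hmk ih =>
    have a1 : ((latticeGraph D).induce Y).Adj ⟨ω k, hY k hmk⟩
        ⟨ω (k + 1), hY _ (Nat.le_succ_of_le hmk)⟩ := hadj k
    have a2 : ((latticeGraph D).induce Z).Adj ⟨ω k, hZ k (hnm.trans hmk)⟩
        ⟨ω (k + 1), hZ _ (hnm.trans (Nat.le_succ_of_le hmk))⟩ := hadj k
    have e1 : raySegment hadj hY (Nat.le_succ_of_le hmk) = (raySegment hadj hY hmk).concat a1 :=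
      Nat.leRec_succ _ _ hmk
    have e2 : raySegment hadj hZ (hnm.trans (Nat.le_succ_of_le hmk)) =
        (raySegment hadj hZ (hnm.trans hmk)).concat a2 :=
      Nat.leRec_succ _ _ (hnm.trans hmk)
    rw [e1, e2, ← ih, SimpleGraph.Walk.concat_eq_append, SimpleGraph.Walk.concat_eq_append,
      ← SimpleGraph.Walk.append_assoc, Trail.incl, SimpleGraph.Walk.map_append]
    rfl

/-- `ω` is a proper base ray for `a`: an infinite trail which tends to infinity and which is
eventually contained in the unflawed region of every range. -/
structure IsProperRay {D : ℕ} {A : Type*} [TopologicalSpace A] (𝔄 : Subshift D A)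
    (a : Config D A) (ω : ℕ → Fin D → ℤ) : Prop where
  adj : ∀ n, (latticeGraph D).Adj (ω n) (ω (n + 1))
  tendsto : Filter.Tendsto ω Filter.atTop Filter.cofinite
  eventually_unflawed : ∀ s, ∃ N, ∀ n ≥ N, ω n ∈ 𝔄.unflawed a s

section
variable {D : ℕ} {A : Type*} [TopologicalSpace A] {𝔄 : Subshift D A} {a : Config D A}
  {ω : ℕ → Fin D → ℤ}

open Classical in
/-- The index after which the ray stays in the unflawed region of range `s`. -/
noncomputable def IsProperRay.start (hω : IsProperRay 𝔄 a ω) (s : ℕ) : ℕ :=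
  Nat.find (hω.eventually_unflawed s)

theorem IsProperRay.mem_of_start_le (hω : IsProperRay 𝔄 a ω) {s n : ℕ} (hn : hω.start s ≤ n) :
    ω n ∈ 𝔄.unflawed a s := by
  classical
  exact Nat.find_spec (hω.eventually_unflawed s) n hn

theorem IsProperRay.start_le (hω : IsProperRay 𝔄 a ω) {s N : ℕ}
    (h : ∀ n ≥ N, ω n ∈ 𝔄.unflawed a s) : hω.start s ≤ N := by
  classical
  exact Nat.find_min' (hω.eventually_unflawed s) h

theorem IsProperRay.start_mono (hω : IsProperRay 𝔄 a ω) {s t : ℕ} (h : s ≤ t) :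
    hω.start s ≤ hω.start t :=
  hω.start_le fun _ hn => 𝔄.unflawed_anti a h (hω.mem_of_start_le hn)

/-- The base point on the ray in the unflawed region of range `s`. -/
noncomputable def IsProperRay.base (hω : IsProperRay 𝔄 a ω) (s : ℕ) : 𝔄.unflawed a s :=
  ⟨ω (hω.start s), hω.mem_of_start_le le_rfl⟩

/-- `π₁(𝔾_s(a),ω)`: the fundamental group of the unflawed region of range `s`, based on `ω`. -/
abbrev IsProperRay.LoopClassAt (hω : IsProperRay 𝔄 a ω) (s : ℕ) : Type :=
  LoopClass (𝔄.unflawed a s) (hω.base s)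

/-- The canonical map `π₁(𝔾_t(a),ω) → π₁(𝔾_s(a),ω)` for `s ≤ t`, given by the inclusion
and the segment of `ω` between the base points. -/
noncomputable def IsProperRay.bond (hω : IsProperRay 𝔄 a ω) {s t : ℕ} (h : s ≤ t) :
    hω.LoopClassAt t → hω.LoopClassAt s :=
  LoopClass.push (𝔄.unflawed_anti a h) 
    (raySegment hω.adj (fun _ hk => hω.mem_of_start_le hk) (hω.start_mono h))

/-- (The underlying set of) the projective fundamental group `π₁(𝔾_∞(a),ω)`: the inverse limit of
the `π₁(𝔾_s(a),ω)` as `s → ∞`. -/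
structure IsProperRay.ProjPi1 (hω : IsProperRay 𝔄 a ω) : Type where
  proj : ∀ s, hω.LoopClassAt s
  compat : ∀ s, hω.bond (Nat.le_succ s) (proj (s + 1)) = proj s

/-- The projective residue `res_a(C,ζ) = C(ζ,a)`: represent `ζ ∈ π₁(𝔾_∞(a),ω)` by a closed trail in
an unflawed region whose range exceeds a radius of `C`, and evaluate a local rule of `C` along it.
(The least radius is used. For abelian coefficients the value does not depend on such choices; in
general it is determined up to conjugation, so that its being trivial is well defined.) -/
noncomputable def IsProperRay.res [DiscreteTopology A] [Finite A] (hω : IsProperRay 𝔄 a ω)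
    {G : Type*} [Group G] (C : Cocycle 𝔄 G) (ζ : hω.ProjPi1) : G :=
  open Classical in
  C.residue (Nat.find_spec C.exists_isLocallyDetermined) (Nat.lt_succ_self _) a (ζ.proj _)

/-- A proper base ray for `a` is one for `Φ(a)`. -/
theorem IsProperRay.image {Φ : CellularAutomaton D A} {R : ℕ} (hω : IsProperRay 𝔄 a ω)
    (hR : Φ.HasRadius R) (hΦ : 𝔄.IsInvariant Φ) : IsProperRay 𝔄 (Φ.toFun a) ω where
  adj := hω.adj
  tendsto := hω.tendsto
  eventually_unflawed s := by
    obtain ⟨N, hN⟩ := hω.eventually_unflawed (R + s)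
    exact ⟨N, fun n hn => Subshift.unflawed_subset hR hΦ a s (hN n hn)⟩

theorem IsProperRay.start_image_le {Φ : CellularAutomaton D A} {R : ℕ} (hω : IsProperRay 𝔄 a ω)
    (hR : Φ.HasRadius R) (hΦ : 𝔄.IsInvariant Φ) (s : ℕ) :
    (hω.image hR hΦ).start s ≤ hω.start (R + s) :=
  (hω.image hR hΦ).start_le fun _ hn =>
    Subshift.unflawed_subset hR hΦ a s (hω.mem_of_start_le hn)

/-- The map `π₁(𝔾_{R+s}(a),ω) → π₁(𝔾_s(Φ(a)),ω)` induced by the inclusion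
`𝔾_{R+s}(a) ⊆ 𝔾_s(Φ(a))`. -/
noncomputable def IsProperRay.imageMapAt {Φ : CellularAutomaton D A} {R : ℕ}
    (hω : IsProperRay 𝔄 a ω) (hR : Φ.HasRadius R) (hΦ : 𝔄.IsInvariant Φ) (s : ℕ) :
    hω.LoopClassAt (R + s) → (hω.image hR hΦ).LoopClassAt s :=
  LoopClass.push (Subshift.unflawed_subset hR hΦ a s)
    (raySegment hω.adj (fun _ hk => (hω.image hR hΦ).mem_of_start_le hk)
      (hω.start_image_le hR hΦ s))

/-- The map `π₁(𝔾_∞(a),ω) → π₁(𝔾_∞(Φ(a)),ω)` induced by the inclusions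
`𝔾_{R+s}(a) ⊆ 𝔾_s(Φ(a))`. -/
noncomputable def IsProperRay.imageMap {Φ : CellularAutomaton D A} {R : ℕ}
    (hω : IsProperRay 𝔄 a ω) (hR : Φ.HasRadius R) (hΦ : 𝔄.IsInvariant Φ) (ζ : hω.ProjPi1) :
    (hω.image hR hΦ).ProjPi1 where
  proj s := hω.imageMapAt hR hΦ s (ζ.proj (R + s))
  compat s := by
    rw [← ζ.compat (R + s)]
    unfold IsProperRay.imageMapAt IsProperRay.bond
    erw [LoopClass.push_push, LoopClass.push_push]
    congr 1
    erw [raySegment_append, raySegment_append]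

/-- `a` has a (projective) `G`-pole (along the proper base ray `ω`): the residue is nontrivial. -/
def HasPole [DiscreteTopology A] [Finite A] (𝔄 : Subshift D A) (G : Type*) [Group G]
    (a : Config D A) (ω : ℕ → Fin D → ℤ) : Prop :=
  ∃ (hω : IsProperRay 𝔄 a ω) (C : Cocycle 𝔄 G) (ζ : hω.ProjPi1), hω.res C ζ ≠ 1

end

/-- The defect of `a` is `Φ`-persistent: `Φ^t(a)` is defective for all `t`. -/
def IsPersistent {D : ℕ} {A : Type*} [TopologicalSpace A] (𝔄 : Subshift D A)
    (Φ : CellularAutomaton D A) (a : Config D A) : Prop :=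
  ∀ t : ℕ, 𝔄.IsDefective (Φ.toFun^[t] a)

/-! ### Admissible blocks and functions of finite range. -/

section
variable {D : ℕ} {A : Type*} [TopologicalSpace A] {𝔄 : Subshift D A} {G H : Type*} [Group G]
  [Group H]

/-! Around a site of `𝔾_s(a)` the configuration agrees on a box with an element `x` of `𝔄`, and for
`s > r` that box holds the `r`-blocks at the site and at its neighbours. So every identity between
cocycles on `𝔄` passes to local rules along trails. An automaton of radius `R` turns the
`(R+r)`-block of `x` into the `r`-block of `Φ(x)`, so the rule of `C` read along a trail in `Φ(a)`
is the rule of `Φ_*C` read in `a` (`Cocycle.along_pullback`).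

Changing the radius or the range, moving the base point along the ray, or replacing `C` by a
cohomologous cocycle alters a residue only by conjugation; the comparisons are therefore stated with
`IsConj`, which for abelian groups is equality. Closed trails have displacement zero, so residues
vanish on elements of `𝔄` (`IsProperRay.res_of_mem`) and for homomorphisms. Hence a pole forces a
defect, and whether a cocycle detects a pole depends only on its class.

If `Φ_*C'` and `C` have the same class, `C'` has at `Φ(a)` the residue that `C` has at `a`
(`IsProperRay.res_imageMap_isConj`), so surjectivity of `Φ_*` carries poles forward. If `C*` is
fundamental, every residue is conjugate to a homomorphic image of that of `C*`, and `Φ` acts on the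
latter as `φ`. Nontriviality of all `φ^n ∘ res*`, automatic when `φ` is injective and a pole exists,
then gives a pole at every iterate. -/

theorem Subshift.exists_block {a : Config D A} {s : ℕ} (hs : 0 < s) {z : Fin D → ℤ}
    (hz : z ∈ 𝔄.unflawed a s) : ∃ x : 𝔄.carrier, ∀ i ∈ box D s, x.1 i = a (i + z) := by
  obtain ⟨x, hx, hxa⟩ := (𝔄.mem_unflawed_iff hs).mp hz
  exact ⟨⟨x, hx⟩, hxa⟩

theorem Subshift.mem_unflawed_of_mem_carrier {a : Config D A} (ha : a ∈ 𝔄.carrier) (s : ℕ)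
    (z : Fin D → ℤ) : z ∈ 𝔄.unflawed a s := by
  -- `mem_unflawed_iff` needs a positive range, and `s` may be `0`; hence the detour through `s +
  -- 1`.
  refine 𝔄.unflawed_anti a (Nat.le_succ s) ((𝔄.mem_unflawed_iff s.succ_pos).mpr ?_)
  exact ⟨shift z a, 𝔄.shift_mem z a ha, fun i _ => rfl⟩

/-- A locally constant function on a subshift depends only on a finite block. -/
theorem IsLocallyConstant.exists_radius [DiscreteTopology A] [Finite A] {X : Type*}
    {b : 𝔄.carrier → X} (hb : IsLocallyConstant b) :
    ∃ r : ℕ, ∀ x x' : 𝔄.carrier, (∀ i ∈ box D r, x.1 i = x'.1 i) → b x = b x' := by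
  have : CompactSpace 𝔄.carrier := isCompact_iff_compactSpace.mp 𝔄.isClosed.isCompact
  -- Compactness: the pairs that `b` separates form a compact set, while the pairs agreeing on
  -- `𝔹(r)` form closed sets decreasing to the diagonal, so one of the latter misses `K`.
  let K : Set (𝔄.carrier × 𝔄.carrier) := {p | b p.1 ≠ b p.2}
  let S : ℕ → Set (𝔄.carrier × 𝔄.carrier) := fun r => {p | ∀ i ∈ box D r, p.1.1 i = p.2.1 i}
  have hK : IsCompact K := by
    apply IsClosed.isCompact
    have h1 : IsLocallyConstant (fun p : 𝔄.carrier × 𝔄.carrier => (b p.1, b p.2)) :=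
      (hb.comp_continuous continuous_fst).prodMk (hb.comp_continuous continuous_snd)
    exact ⟨h1 {q | ¬ q.1 ≠ q.2}⟩
  have hS : ∀ r, IsClosed (S r) := by
    intro r
    simp only [S, Set.ofPred_forall]
    refine isClosed_iInter fun i => isClosed_iInter fun _ => ?_
    exact isClosed_eq
      ((continuous_apply i).comp (continuous_subtype_val.comp continuous_fst))
      ((continuous_apply i).comp (continuous_subtype_val.comp continuous_snd))
  have hdir : Directed (· ⊇ ·) S := fun r s =>
    ⟨max r s, fun p hp i hi => hp i (box_mono (le_max_left _ _) hi),
      fun p hp i hi => hp i (box_mono (le_max_right _ _) hi)⟩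
  have hemp : K ∩ ⋂ r, S r = ∅ := by
    ext p
    simp only [Set.mem_inter_iff, Set.mem_iInter, Set.mem_empty_iff_false, iff_false, not_and]
    intro hp hall
    apply hp
    have : p.1 = p.2 := by
      apply Subtype.ext
      funext i
      refine hall (∑ k, (i k).natAbs) i fun k => ?_
      have h1 : (i k).natAbs ≤ ∑ k, (i k).natAbs :=
        Finset.single_le_sum (f := fun k => (i k).natAbs) (fun _ _ => Nat.zero_le _)
          (Finset.mem_univ k)
      rw [Int.abs_eq_natAbs]
      exact_mod_cast h1
    rw [this]
  obtain ⟨r, hr⟩ := hK.elim_directed_family_closed S hS hemp hdir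
  refine ⟨r, fun x x' hxx => ?_⟩
  by_contra hne
  have : (x, x') ∈ K ∩ S r := ⟨hne, hxx⟩
  rw [hr] at this
  exact this

/-! ### Cocycles along trails -/

theorem Cocycle.IsLocallyDetermined.mono {C : Cocycle 𝔄 G} {r s : ℕ}
    (hC : C.IsLocallyDetermined r) (h : r ≤ s) : C.IsLocallyDetermined s :=
  fun e he x x' hxx => hC e he x x' fun i hi => hxx i (box_mono h hi)

theorem Cocycle.along_incl (C : Cocycle 𝔄 G) (r : ℕ) (a : Config D A) {Y Z : Set (Fin D → ℤ)}
    (h : Y ⊆ Z) {x y : Y} (p : Trail Y x y) : C.along r a (Trail.incl h p) = C.along r a p := by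
  induction p with
  | nil => rfl
  | cons hadj p ih => exact congrArg (· * _) ih

/-- A step and its reversal both take place inside one element `x` of `𝔄`, because `s > r`; their
product is `C(0,x) = 1`. -/
theorem Cocycle.along_reverse {C : Cocycle 𝔄 G} {r s : ℕ} (hC : C.IsLocallyDetermined r)
    (hs : r < s) {a : Config D A} {x y : 𝔄.unflawed a s} (p : Trail (𝔄.unflawed a s) x y) :
    C.along r a p.reverse = (C.along r a p)⁻¹ := by
  induction p with
  | nil => simp [Cocycle.along]
  | @cons u v w h p ih =>
    obtain ⟨x, hx⟩ := Subshift.exists_block (by omega) u.2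
    have e := Cocycle.localRule_two hC hs (u := u.1) (v := v.1) (w := u.1) h h.symm x hx
    rw [sub_self, Cocycle.map_zero] at e
    simp only [SimpleGraph.Walk.reverse_cons, Cocycle.along_append, Cocycle.along, ih, one_mul,
      mul_inv_rev]
    rw [eq_inv_of_mul_eq_one_left e]

/-- The value along a trail in a sufficiently unflawed region does not depend on the radius. -/
theorem Cocycle.along_radius {C : Cocycle 𝔄 G} {r r' s : ℕ} (hC : C.IsLocallyDetermined r)
    (hC' : C.IsLocallyDetermined r') (hs : r < s) (hs' : r' < s) {a : Config D A}
    {x y : 𝔄.unflawed a s} (p : Trail (𝔄.unflawed a s) x y) :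
    C.along r a p = C.along r' a p := by
  induction p with
  | nil => rfl
  | @cons u v w h p ih =>
    obtain ⟨x, hx⟩ := Subshift.exists_block (by omega) u.2
    have h1 : v.1 - u.1 ∈ unitSteps D := h
    rw [Cocycle.along, Cocycle.along, ih,
      Cocycle.localRule_eq hC h1 x fun i hi => hx i (box_mono hs.le hi),
      Cocycle.localRule_eq hC' h1 x fun i hi => hx i (box_mono hs'.le hi)]

theorem Cocycle.IsLocallyDetermined.comp {C : Cocycle 𝔄 G} {r : ℕ}
    (hC : C.IsLocallyDetermined r) (ψ : G →* H) : (C.comp ψ).IsLocallyDetermined r :=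
  fun e he x x' hxx => congrArg ψ (hC e he x x' hxx)

theorem Cocycle.along_comp (C : Cocycle 𝔄 G) (ψ : G →* H) (r : ℕ) (a : Config D A)
    {Y : Set (Fin D → ℤ)} {x y : Y} (p : Trail Y x y) :
    (C.comp ψ).along r a p = ψ (C.along r a p) := by
  induction p with
  | nil => exact (map_one ψ).symm
  | cons h p ih =>
    rw [Cocycle.along, Cocycle.along, ih, map_mul]
    congr 1
    unfold Cocycle.localRule
    -- On an inadmissible block both rules have the default value `1`, which `ψ` preserves, so `p`
    -- may lie in any `Y`.
    split_ifs
    · rfl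
    · exact (map_one ψ).symm

/-- A transfer function changes the values along trails by its values at the end points. -/
theorem Cocycle.along_transfer {C C' : Cocycle 𝔄 G} {b : 𝔄.carrier → G}
    (hCC : ∀ (z : Fin D → ℤ) (x : 𝔄.carrier),
      C'.toFun z x = b (𝔄.shiftMap z x) * C.toFun z x * (b x)⁻¹)
    {r s : ℕ} (hC : C.IsLocallyDetermined r) (hC' : C'.IsLocallyDetermined r)
    (hb : ∀ x x' : 𝔄.carrier, (∀ i ∈ box D r, x.1 i = x'.1 i) → b x = b x') (hs : r < s)
    {a : Config D A} {x y : 𝔄.unflawed a s} (p : Trail (𝔄.unflawed a s) x y)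
    {ξ η : 𝔄.carrier} (hξ : ∀ i ∈ box D r, ξ.1 i = a (i + x.1))
    (hη : ∀ i ∈ box D r, η.1 i = a (i + y.1)) :
    C'.along r a p = b η * C.along r a p * (b ξ)⁻¹ := by
  induction p generalizing ξ with
  | nil =>
    have : b η = b ξ := hb _ _ fun i hi => (hη i hi).trans (hξ i hi).symm
    simp [Cocycle.along, this]
  | @cons u v w h p ih =>
    obtain ⟨x, hx⟩ := Subshift.exists_block (by omega) u.2
    have hxξ : b ξ = b x := hb _ _ fun i hi =>
      (hξ i hi).trans (hx i (box_mono hs.le hi)).symm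
    have h1 : v.1 - u.1 ∈ unitSteps D := h
    -- Since `r + 1 ≤ s`, the shift of `x` still matches `a` on the `r`-box about `v`; it takes the
    -- place of `ξ` for the rest of the trail, and the values of `b` telescope.
    have hv : ∀ i ∈ box D r, (𝔄.shiftMap (v.1 - u.1) x).1 i = a (i + v.1) := fun i hi => by
      have := hx (i + (v.1 - u.1)) (box_mono hs (box_add hi (unitSteps_box h1)))
      simpa [Subshift.shiftMap, shift, add_assoc] using this
    rw [Cocycle.along, Cocycle.along, ih hv hη,
      Cocycle.localRule_eq hC h1 x fun i hi => hx i (box_mono hs.le hi),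
      Cocycle.localRule_eq hC' h1 x fun i hi => hx i (box_mono hs.le hi), hCC, hxξ]
    group

/-- In an element of the subshift, the value along a trail is the value of the cocycle. -/
theorem Cocycle.along_of_mem {C : Cocycle 𝔄 G} {r : ℕ} (hC : C.IsLocallyDetermined r)
    {a : Config D A} (ha : a ∈ 𝔄.carrier) {Y : Set (Fin D → ℤ)} {x y : Y} (p : Trail Y x y) :
    C.along r a p = C.toFun (y.1 - x.1) (𝔄.shiftMap x.1 ⟨a, ha⟩) := by
  induction p with
  | nil => rw [sub_self, Cocycle.map_zero]; rfl
  | @cons u v w h p ih =>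
    have h1 : v.1 - u.1 ∈ unitSteps D := h
    rw [Cocycle.along, ih,
      Cocycle.localRule_eq hC h1 (𝔄.shiftMap u.1 ⟨a, ha⟩) fun i _ => rfl,
      ← sub_add_sub_cancel w.1 v.1 u.1, Cocycle.cocycle_eq]
    congr 2
    apply Subtype.ext
    funext i
    simp [Subshift.shiftMap, shift, add_assoc]

/-- A homomorphism takes the value at the displacement along any trail. -/
theorem Cocycle.along_ofHom (h : Multiplicative (Fin D → ℤ) →* G) (r : ℕ) {s : ℕ} (hs : r < s)
    {a : Config D A} {x y : 𝔄.unflawed a s} (p : Trail (𝔄.unflawed a s) x y) :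
    (Cocycle.ofHom 𝔄 h).along r a p = h (Multiplicative.ofAdd (y.1 - x.1)) := by
  induction p with
  | nil => rw [sub_self, ofAdd_zero, map_one]; rfl
  | @cons u v w hadj p ih =>
    obtain ⟨x, hx⟩ := Subshift.exists_block (by omega) u.2
    have h1 : v.1 - u.1 ∈ unitSteps D := hadj
    rw [Cocycle.along, ih, Cocycle.localRule_eq (C := Cocycle.ofHom 𝔄 h) (r := r)
      (fun _ _ _ _ _ => rfl) h1 x fun i hi => hx i (box_mono hs.le hi),
      ← sub_add_sub_cancel w.1 v.1 u.1, ofAdd_add, map_mul]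
    rfl

theorem Cocycle.IsLocallyDetermined.pullback {Φ : CellularAutomaton D A} {R : ℕ}
    (hR : Φ.HasRadius R) (hΦ : 𝔄.IsInvariant Φ) {C : Cocycle 𝔄 G} {r : ℕ}
    (hC : C.IsLocallyDetermined r) : (C.pullback hΦ).IsLocallyDetermined (R + r) :=
  fun e he _ _ hxx => hC e he _ _ fun _ hi =>
    hR.apply fun _ hj => hxx _ (box_add hj hi)

/-- If `x ∈ 𝔄` matches `a` on the `(R+r)`-box, then `Φ(x)` matches `Φ(a)` on the `r`-box, so the two
rules agree step by step. Single steps need no slack: `s = R + r` is allowed, as trails require, and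
larger `s` serves the residues. -/
theorem Cocycle.along_pullback {Φ : CellularAutomaton D A} {R : ℕ}
    (hR : Φ.HasRadius R) (hΦ : 𝔄.IsInvariant Φ) {C : Cocycle 𝔄 G} {r s : ℕ}
    (hC : C.IsLocallyDetermined r) (hs0 : 0 < s) (hs : R + r ≤ s) {a : Config D A}
    {x y : 𝔄.unflawed a s} (p : Trail (𝔄.unflawed a s) x y) :
    C.along r (Φ.toFun a) p = (C.pullback hΦ).along (R + r) a p := by
  induction p with
  | nil => rfl
  | @cons u v w h p ih =>
    obtain ⟨x, hx⟩ := Subshift.exists_block hs0 u.2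
    have h1 : v.1 - u.1 ∈ unitSteps D := h
    rw [Cocycle.along, Cocycle.along, ih, Cocycle.localRule_eq (hC.pullback hR hΦ) h1 x
      fun i hi => hx i (box_mono hs hi)]
    congr 1
    refine Cocycle.localRule_eq hC h1 ⟨Φ.toFun x.1, hΦ _ x.2⟩ fun i hi => ?_
    have h2 : Φ.toFun x.1 i = Φ.toFun (shift u.1 a) i :=
      hR.apply fun j hj => hx (j + i) (box_mono hs (box_add hj hi))
    exact h2.trans (by rw [Φ.comm_shift]; rfl)

theorem Cocycle.along_mul {K : Type*} [CommGroup K] {C C' : Cocycle 𝔄 K} {r s : ℕ}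
    (hC : C.IsLocallyDetermined r) (hC' : C'.IsLocallyDetermined r)
    (hCC : (C * C').IsLocallyDetermined r) (hs : r < s) {a : Config D A} {x y : 𝔄.unflawed a s}
    (p : Trail (𝔄.unflawed a s) x y) :
    (C * C').along r a p = C.along r a p * C'.along r a p := by
  induction p with
  | nil => exact (mul_one 1).symm
  | @cons u v w h p ih =>
    obtain ⟨x, hx⟩ := Subshift.exists_block (by omega) u.2
    have hx' : ∀ i ∈ box D r, x.1 i = a (i + u.1) := fun i hi => hx i (box_mono hs.le hi)
    have h1 : v.1 - u.1 ∈ unitSteps D := h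
    rw [Cocycle.along, Cocycle.along, Cocycle.along, ih, Cocycle.localRule_eq hC h1 x hx',
      Cocycle.localRule_eq hC' h1 x hx', Cocycle.localRule_eq hCC h1 x hx', mul_mul_mul_comm]
    rfl

/-! ### Residues up to conjugacy -/

theorem Cocycle.residue_radius {C : Cocycle 𝔄 G} {r r' s : ℕ} (hC : C.IsLocallyDetermined r)
    (hC' : C.IsLocallyDetermined r') (hs : r < s) (hs' : r' < s) {a : Config D A}
    {x : 𝔄.unflawed a s} (ζ : LoopClass (𝔄.unflawed a s) x) :
    C.residue hC hs a ζ = C.residue hC' hs' a ζ := by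
  induction ζ using Quotient.inductionOn with
  | h p => exact Cocycle.along_radius hC hC' hs hs' p

/-- The detour `q` and its reverse contribute mutually inverse factors, so moving the base point
conjugates by the value along `q`. -/
theorem Cocycle.residue_push_isConj {C : Cocycle 𝔄 G} {r s t : ℕ}
    (hC : C.IsLocallyDetermined r) (hs : r < s) (ht : r < t) {a : Config D A}
    (h : 𝔄.unflawed a t ⊆ 𝔄.unflawed a s) {x : 𝔄.unflawed a t} {x' : 𝔄.unflawed a s}
    (q : Trail (𝔄.unflawed a s) x' ⟨x.1, h x.2⟩) (ζ : LoopClass (𝔄.unflawed a t) x) :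
    IsConj (C.residue hC hs a (LoopClass.push h q ζ)) (C.residue hC ht a ζ) := by
  induction ζ using Quotient.inductionOn with
  | h p =>
    change IsConj (C.along r a (q.append ((Trail.incl h p).append q.reverse))) (C.along r a p)
    rw [Cocycle.along_append, Cocycle.along_append, Cocycle.along_incl,
      Cocycle.along_reverse hC hs]
    exact isConj_iff.mpr ⟨C.along r a q, by group⟩

theorem Cocycle.residue_comp {C : Cocycle 𝔄 G} {r s : ℕ} (hC : C.IsLocallyDetermined r)
    (ψ : G →* H) (hs : r < s) {a : Config D A} {x : 𝔄.unflawed a s}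
    (ζ : LoopClass (𝔄.unflawed a s) x) :
    (C.comp ψ).residue (hC.comp ψ) hs a ζ = ψ (C.residue hC hs a ζ) := by
  induction ζ using Quotient.inductionOn with
  | h p => exact Cocycle.along_comp C ψ r a p

theorem Cocycle.residue_pullback_isConj {Φ : CellularAutomaton D A} {R : ℕ}
    (hR : Φ.HasRadius R) (hΦ : 𝔄.IsInvariant Φ) {C : Cocycle 𝔄 G} {r s : ℕ}
    (hC : C.IsLocallyDetermined r) (hs : r < s) {a : Config D A}
    {x : 𝔄.unflawed a (R + s)} {x' : 𝔄.unflawed (Φ.toFun a) s}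
    (q : Trail (𝔄.unflawed (Φ.toFun a) s) x' ⟨x.1, Subshift.unflawed_subset hR hΦ a s x.2⟩)
    (ζ : LoopClass (𝔄.unflawed a (R + s)) x) :
    IsConj (C.residue hC hs (Φ.toFun a)
        (LoopClass.push (Subshift.unflawed_subset hR hΦ a s) q ζ))
      ((C.pullback hΦ).residue (hC.pullback hR hΦ) (Nat.add_lt_add_left hs R) a ζ) := by
  induction ζ using Quotient.inductionOn with
  | h p =>
    change IsConj (C.along r (Φ.toFun a) (q.append ((Trail.incl _ p).append q.reverse)))
      ((C.pullback hΦ).along (R + r) a p)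
    rw [Cocycle.along_append, Cocycle.along_append, Cocycle.along_incl,
      Cocycle.along_reverse hC hs, Cocycle.along_pullback hR hΦ hC (by omega) (by omega)]
    exact isConj_iff.mpr ⟨C.along r (Φ.toFun a) q, by group⟩

end

/-! ### Projective residues and poles along a base ray. -/

section
variable {D : ℕ} {A : Type*} [TopologicalSpace A] {𝔄 : Subshift D A}
  {a : Config D A} {ω : ℕ → Fin D → ℤ} {G H : Type*} [Group G] [Group H]

theorem IsProperRay.residue_proj_isConj (hω : IsProperRay 𝔄 a ω) {C : Cocycle 𝔄 G} {r s t : ℕ}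
    (hC : C.IsLocallyDetermined r) (hs : r < s) (hst : s ≤ t) (ζ : hω.ProjPi1) :
    IsConj (C.residue hC hs a (ζ.proj s)) (C.residue hC (hs.trans_le hst) a (ζ.proj t)) := by
  induction t, hst using Nat.le_induction with
  | base => exact IsConj.refl _
  | succ t hst ih =>
    refine ih.trans ?_
    rw [← ζ.compat t]
    exact Cocycle.residue_push_isConj hC _ _ _ _ _

theorem Cocycle.Cohomologous.comp {C C' : Cocycle 𝔄 G}
    (h : C.Cohomologous C') (ψ : G →* H) : (C.comp ψ).Cohomologous (C'.comp ψ) := by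
  obtain ⟨b, hb, h⟩ := h
  refine ⟨ψ ∘ b, hb.comp ψ, fun z x => ?_⟩
  have := congrArg ψ (h z x)
  rwa [map_mul, map_mul, map_inv] at this

/-- The ray itself meets unflawed regions of every range, so a pole brings with it half of the
definition of being defective. -/
theorem IsProperRay.mem_slightlyDefective (hω : IsProperRay 𝔄 a ω) :
    a ∈ 𝔄.slightlyDefective := by
  refine ENat.eq_top_iff_forall_ge.mpr fun s => ?_
  obtain ⟨N, hN⟩ := hω.eventually_unflawed s
  exact le_iSup_of_le (ω N) (hN N le_rfl)

variable [DiscreteTopology A] [Finite A]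

/-- Up to conjugacy, the projective residue may be computed at any radius and any larger range. -/
theorem IsProperRay.res_isConj_residue (hω : IsProperRay 𝔄 a ω) {C : Cocycle 𝔄 G} {r s : ℕ}
    (hC : C.IsLocallyDetermined r) (hs : r < s) (ζ : hω.ProjPi1) :
    IsConj (hω.res C ζ) (C.residue hC hs a (ζ.proj s)) := by
  classical
  have h0 := Nat.find_spec C.exists_isLocallyDetermined
  set r₀ := Nat.find C.exists_isLocallyDetermined
  -- The least radius `r₀` and the given `r` are compared at the common range `max (r₀ + 1) s`,
  -- where both rules apply.
  refine (hω.residue_proj_isConj h0 (Nat.lt_succ_self r₀) (le_max_left (r₀ + 1) s) ζ).trans ?_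
  rw [Cocycle.residue_radius h0 hC _ (hs.trans_le (le_max_right _ _))]
  exact (hω.residue_proj_isConj hC hs (le_max_right (r₀ + 1) s) ζ).symm

theorem Cocycle.Cohomologous.res_isConj {C C' : Cocycle 𝔄 G} (h : C.Cohomologous C')
    (hω : IsProperRay 𝔄 a ω) (ζ : hω.ProjPi1) : IsConj (hω.res C ζ) (hω.res C' ζ) := by
  obtain ⟨b, hb, h⟩ := h
  obtain ⟨r₁, h₁⟩ := C.exists_isLocallyDetermined
  obtain ⟨r₂, h₂⟩ := C'.exists_isLocallyDetermined
  obtain ⟨r₃, h₃⟩ := hb.exists_radius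
  obtain ⟨r, hr₁, hr₂, hr₃⟩ : ∃ r, r₁ ≤ r ∧ r₂ ≤ r ∧ r₃ ≤ r :=
    ⟨r₁ + r₂ + r₃, by omega, by omega, by omega⟩
  have hC := h₁.mono hr₁
  have hC' := h₂.mono hr₂
  have hs : r < r + 1 := Nat.lt_succ_self r
  refine (hω.res_isConj_residue hC hs ζ).trans
    (IsConj.trans ?_ (hω.res_isConj_residue hC' hs ζ).symm)
  induction ζ.proj (r + 1) using Quotient.inductionOn with
  | h p =>
    obtain ⟨x, hx⟩ := Subshift.exists_block (Nat.succ_pos r) (hω.base (r + 1)).2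
    have hx' : ∀ i ∈ box D r, x.1 i = a (i + (hω.base (r + 1)).1) :=
      fun i hi => hx i (box_mono hs.le hi)
    -- On a closed trail both ends carry the same block, so the two transfer factors are `b x` and
    -- its inverse.
    exact isConj_iff.mpr ⟨b x, (Cocycle.along_transfer h hC hC'
      (fun x x' hxx => h₃ x x' fun i hi => hxx i (box_mono hr₃ hi)) hs p hx' hx').symm⟩

theorem IsProperRay.res_comp_isConj (hω : IsProperRay 𝔄 a ω) (C : Cocycle 𝔄 G) (ψ : G →* H)
    (ζ : hω.ProjPi1) : IsConj (hω.res (C.comp ψ) ζ) (ψ (hω.res C ζ)) := by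
  obtain ⟨r, hC⟩ := C.exists_isLocallyDetermined
  refine (hω.res_isConj_residue (hC.comp ψ) (Nat.lt_succ_self r) ζ).trans ?_
  rw [Cocycle.residue_comp]
  exact (ψ.map_isConj (hω.res_isConj_residue hC (Nat.lt_succ_self r) ζ)).symm

theorem IsProperRay.res_imageMap_isConj {Φ : CellularAutomaton D A} {R : ℕ}
    (hω : IsProperRay 𝔄 a ω) (hR : Φ.HasRadius R) (hΦ : 𝔄.IsInvariant Φ) (C : Cocycle 𝔄 G)
    (ζ : hω.ProjPi1) :
    IsConj ((hω.image hR hΦ).res C (hω.imageMap hR hΦ ζ)) (hω.res (C.pullback hΦ) ζ) := by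
  obtain ⟨r, hC⟩ := C.exists_isLocallyDetermined
  refine ((hω.image hR hΦ).res_isConj_residue hC (Nat.lt_succ_self r) _).trans
    (IsConj.trans ?_ (hω.res_isConj_residue (hC.pullback hR hΦ)
      (Nat.add_lt_add_left (Nat.lt_succ_self r) R) ζ).symm)
  -- By definition `imageMap` builds its component of range `r + 1` from the component of `ζ` of
  -- range `R + (r + 1)`.
  exact Cocycle.residue_pullback_isConj hR hΦ hC (Nat.lt_succ_self r) _ _

/-- Without a defect the value along a trail depends only on its end points, and `C(0,·) = 1`. This
is what makes a pole an obstruction to lying in `𝔄`. -/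
theorem IsProperRay.res_of_mem (hω : IsProperRay 𝔄 a ω) (ha : a ∈ 𝔄.carrier) (C : Cocycle 𝔄 G)
    (ζ : hω.ProjPi1) : hω.res C ζ = 1 := by
  obtain ⟨r, hC⟩ := C.exists_isLocallyDetermined
  have h := hω.res_isConj_residue hC (Nat.lt_succ_self r) ζ
  induction hp : ζ.proj (r + 1) using Quotient.inductionOn with
  | h p =>
    rw [hp] at h
    have e : C.along r a p = 1 := by
      rw [Cocycle.along_of_mem hC ha p, sub_self, Cocycle.map_zero]
    change IsConj _ (C.along r a p) at h
    exact isConj_one_left.mp (e ▸ h)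

theorem HasPole.isDefective (h : HasPole 𝔄 G a ω) : 𝔄.IsDefective a := by
  obtain ⟨hω, C, ζ, hne⟩ := h
  exact ⟨hω.mem_slightlyDefective, fun ha => hne (hω.res_of_mem ha C ζ)⟩

theorem IsProperRay.res_ne_one_of_hasPole {C : Cocycle 𝔄 G}
    (h : ∀ C' : Cocycle 𝔄 H, ∃ ψ : G →* H, C'.Cohomologous (C.comp ψ))
    (hω : IsProperRay 𝔄 a ω) (hp : HasPole 𝔄 H a ω) : ∃ ζ, hω.res C ζ ≠ 1 := by
  -- The proof of properness inside `HasPole` may be dropped: by proof irrelevance `ζ` is also a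
  -- class for `hω`.
  obtain ⟨_, C', ζ, hne⟩ := hp
  obtain ⟨ψ, hψ⟩ := h C'
  refine ⟨ζ, fun h1 => hne (isConj_one_left.mp ?_)⟩
  have h2 := (hψ.res_isConj hω ζ).trans (hω.res_comp_isConj C ψ ζ)
  rw [h1, map_one] at h2
  exact h2

/-- Poles which pass from every configuration to its image are persistent. -/
theorem HasPole.iterate {Φ : CellularAutomaton D A}
    (hstep : ∀ a, HasPole 𝔄 G a ω → HasPole 𝔄 G (Φ.toFun a) ω) (h : HasPole 𝔄 G a ω) :
    IsPersistent 𝔄 Φ a ∧ ∀ t : ℕ, HasPole 𝔄 G (Φ.toFun^[t] a) ω := by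
  have key : ∀ t : ℕ, HasPole 𝔄 G (Φ.toFun^[t] a) ω := fun t => by
    induction t with
    | zero => exact h
    | succ t ih => rw [Function.iterate_succ_apply']; exact hstep _ ih
  exact ⟨fun t => (key t).isDefective, key⟩

/-- A pole passes to the image if the cocycle has the same residues, up to conjugacy, as one
induced by the automaton. -/
theorem HasPole.image {Φ : CellularAutomaton D A} {R : ℕ} (hR : Φ.HasRadius R)
    (hΦ : 𝔄.IsInvariant Φ) (hsurj : ∀ C : Cocycle 𝔄 G, ∃ C' : Cocycle 𝔄 G,
      ∀ (hω : IsProperRay 𝔄 a ω) (ζ : hω.ProjPi1),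
        IsConj (hω.res (C'.pullback hΦ) ζ) (hω.res C ζ))
    (h : HasPole 𝔄 G a ω) : HasPole 𝔄 G (Φ.toFun a) ω := by
  obtain ⟨hω, C, ζ, hne⟩ := h
  obtain ⟨C', hC'⟩ := hsurj C
  refine ⟨hω.image hR hΦ, C', hω.imageMap hR hΦ ζ, fun h1 => hne ?_⟩
  have h2 := (hω.res_imageMap_isConj hR hΦ C' ζ).trans (hC' hω ζ)
  rw [h1] at h2
  exact isConj_one_right.mp h2

end

/-! ### Abelian coefficients and induced endomorphisms. -/

section
variable {D : ℕ} {A : Type*} [TopologicalSpace A] [DiscreteTopology A] [Finite A]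
  {𝔄 : Subshift D A} {a : Config D A} {ω : ℕ → Fin D → ℤ}

/-- Together with `Cocycle.IsTrivial.res_eq_one` this makes the residue depend only on the class in
`DynCohomology`. -/
theorem IsProperRay.res_mul {G : Type*} [CommGroup G] (hω : IsProperRay 𝔄 a ω)
    (C C' : Cocycle 𝔄 G) (ζ : hω.ProjPi1) :
    hω.res (C * C') ζ = hω.res C ζ * hω.res C' ζ := by
  obtain ⟨r₁, h₁⟩ := C.exists_isLocallyDetermined
  obtain ⟨r₂, h₂⟩ := C'.exists_isLocallyDetermined
  have hC := h₁.mono (le_max_left r₁ r₂)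
  have hC' := h₂.mono (le_max_right r₁ r₂)
  have hCC : (C * C').IsLocallyDetermined (max r₁ r₂) := fun e he x x' hxx =>
    congrArg₂ (· * ·) (hC e he x x' hxx) (hC' e he x x' hxx)
  have hs := Nat.lt_succ_self (max r₁ r₂)
  rw [isConj_iff_eq.mp (hω.res_isConj_residue hC hs ζ),
    isConj_iff_eq.mp (hω.res_isConj_residue hC' hs ζ),
    isConj_iff_eq.mp (hω.res_isConj_residue hCC hs ζ)]
  induction ζ.proj (max r₁ r₂ + 1) using Quotient.inductionOn with
  | h p => exact Cocycle.along_mul hC hC' hCC hs p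

theorem Cocycle.IsTrivial.res_eq_one {G : Type*} [Group G] {C : Cocycle 𝔄 G} (h : C.IsTrivial)
    (hω : IsProperRay 𝔄 a ω) (ζ : hω.ProjPi1) : hω.res C ζ = 1 := by
  obtain ⟨f, hf⟩ := h
  -- The cocycle of a homomorphism ignores the configuration, so radius `0` suffices.
  have h1 := (hf.res_isConj hω ζ).trans (hω.res_isConj_residue (r := 0) (s := 1)
    (fun _ _ _ _ _ => rfl) Nat.zero_lt_one ζ)
  induction hp : ζ.proj 1 using Quotient.inductionOn with
  | h p =>
    rw [hp] at h1
    have e : (Cocycle.ofHom 𝔄 f).along 0 a p = 1 := by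
      rw [Cocycle.along_ofHom f 0 Nat.zero_lt_one p, sub_self, ofAdd_zero, map_one]
    change IsConj _ ((Cocycle.ofHom 𝔄 f).along 0 a p) at h1
    exact isConj_one_left.mp (e ▸ h1)

/-- Only `ε = id` is needed: `Φ_*C ≈ φ ∘ C`, and conjugate elements of an abelian group are equal.
-/
theorem Cocycle.IsInducedEnd.res_imageMap {G : Type*} [CommGroup G] {Φ : CellularAutomaton D A}
    {R : ℕ} {hΦ : 𝔄.IsInvariant Φ} {C : Cocycle 𝔄 G} {φ : G →* G} (hφ : C.IsInducedEnd hΦ φ)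
    (hR : Φ.HasRadius R) (hω : IsProperRay 𝔄 a ω) (ζ : hω.ProjPi1) :
    (hω.image hR hΦ).res C (hω.imageMap hR hΦ ζ) = φ (hω.res C ζ) :=
  isConj_iff_eq.mp ((hω.res_imageMap_isConj hR hΦ C ζ).trans
    (((hφ (MonoidHom.id G)).res_isConj hω ζ).trans (hω.res_comp_isConj C φ ζ)))

theorem Cocycle.IsInducedEnd.iterate {G : Type*} [CommGroup G] {Φ : CellularAutomaton D A}
    {R : ℕ} {hΦ : 𝔄.IsInvariant Φ} {C : Cocycle 𝔄 G} {φ : G →* G} (hφ : C.IsInducedEnd hΦ φ)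
    (hR : Φ.HasRadius R) (hω : IsProperRay 𝔄 a ω)
    (h : ∀ n : ℕ, ∃ ζ, φ^[n] (hω.res C ζ) ≠ 1) (t : ℕ) :
    HasPole 𝔄 G (Φ.toFun^[t] a) ω := by
  induction t generalizing a with
  | zero =>
    obtain ⟨ζ, hζ⟩ := h 0
    exact ⟨hω, C, ζ, hζ⟩
  | succ t ih =>
    -- Each application of `Φ` uses up one `φ`: the condition for `Φ(a)` at `n` is the one for `a`
    -- at `n + 1`.
    refine ih (hω.image hR hΦ) fun n => ?_
    obtain ⟨ζ, hζ⟩ := h (n + 1)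
    refine ⟨hω.imageMap hR hΦ ζ, ?_⟩
    rwa [hφ.res_imageMap hR hω ζ]

end

/-! ### Assembly of the proposition. -/

theorem proposition2p8 {D : ℕ} {A : Type v} [TopologicalSpace A] [DiscreteTopology A]
    [Finite A] (𝔄 : Subshift D A) (Φ : CellularAutomaton D A) (R : ℕ) (hR0 : 0 < R)
    (hR : Φ.HasRadius R) (hΦ : 𝔄.IsInvariant Φ) (a : Config D A) (ha : a ∈ 𝔄.slightlyDefective) :
    -- transformation of residues
    (∀ (G : Type u) [Group G] (C : Cocycle 𝔄 G) (r : ℕ) (hr0 : 0 < r)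
        (hC : C.IsLocallyDetermined r),
      𝔄.unflawed a (R + r) ⊆ 𝔄.unflawed (Φ.toFun a) r ∧
      ∃ hC' : (C.pullback hΦ).IsLocallyDetermined (R + r),
        (∀ (x y : 𝔄.unflawed a (R + r)) (ζ : Trail (𝔄.unflawed a (R + r)) x y),
          C.along r (Φ.toFun a) ζ = (C.pullback hΦ).along (R + r) a ζ) ∧
        (∀ (s : ℕ) (hs : r < s) (x : 𝔄.unflawed a (R + s))
            (ζ : LoopClass (𝔄.unflawed a (R + s)) x),
          C.residue hC hs (Φ.toFun a) (LoopClass.incl (Subshift.unflawed_subset hR hΦ a s) ζ) =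
            (C.pullback hΦ).residue hC' (Nat.add_lt_add_left hs R) a ζ)) ∧
    -- persistence of poles when the induced map on cohomology is surjective,
    -- first for cohomology classes in an arbitrary group, then for abelian cohomology groups
    (∀ (G : Type u) [Group G], Function.Surjective (DynClasses.map hΦ G) →
      ∀ ω, HasPole 𝔄 G a ω →
        IsPersistent 𝔄 Φ a ∧ ∀ t : ℕ, HasPole 𝔄 G (Φ.toFun^[t] a) ω) ∧
    (∀ (G : Type u) [CommGroup G], Function.Surjective (DynCohomology.map G hΦ) →
      ∀ ω, HasPole 𝔄 G a ω →
        IsPersistent 𝔄 Φ a ∧ ∀ t : ℕ, HasPole 𝔄 G (Φ.toFun^[t] a) ω) ∧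
    -- consequences of an abelian fundamental cocycle
    (∀ (Gs : Type u) [CommGroup Gs] (Cs : Cocycle 𝔄 Gs), Cs.IsFundamental →
      (∀ (H : Type u) [CommGroup H] (ω : ℕ → Fin D → ℤ) (hω : IsProperRay 𝔄 a ω),
        HasPole 𝔄 H a ω → ∃ ζ, hω.res Cs ζ ≠ 1) ∧
      (∃ φ : Gs →* Gs, Cs.IsInducedEnd hΦ φ) ∧
      (∀ φ : Gs →* Gs, Cs.IsInducedEnd hΦ φ →
        (∀ (ω : ℕ → Fin D → ℤ) (hω : IsProperRay 𝔄 a ω) (ζ : hω.ProjPi1),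
          (hω.image hR hΦ).res Cs (hω.imageMap hR hΦ ζ) = φ (hω.res Cs ζ)) ∧
        (∀ (ω : ℕ → Fin D → ℤ) (hω : IsProperRay 𝔄 a ω),
          (∀ n : ℕ, ∃ ζ, φ^[n] (hω.res Cs ζ) ≠ 1) → IsPersistent 𝔄 Φ a) ∧
        (Function.Injective φ →
          ∀ (H : Type u) [Group H] (ω : ℕ → Fin D → ℤ), HasPole 𝔄 H a ω →
            IsPersistent 𝔄 Φ a ∧ ∀ t : ℕ, HasPole 𝔄 Gs (Φ.toFun^[t] a) ω))) := by
  refine ⟨fun G _ C r hr0 hC => ⟨Subshift.unflawed_subset hR hΦ a r, hC.pullback hR hΦ,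
    fun x y ζ => Cocycle.along_pullback hR hΦ hC (by omega) le_rfl ζ, fun s hs x ζ => ?_⟩,
    fun G _ hsurj ω hp => ?_, fun G _ hsurj ω hp => ?_, fun Gs _ Cs hCs =>
      ⟨fun H _ ω hω hp => hω.res_ne_one_of_hasPole (hCs H) hp, ?_, fun φ hφ =>
        ⟨fun ω hω ζ => hφ.res_imageMap hR hω ζ, fun ω hω h t =>
          (hφ.iterate hR hω h t).isDefective, fun hinj H _ ω hp => ?_⟩⟩⟩
  · induction ζ using Quotient.inductionOn with
    | h p =>
      -- Here the base point stays fixed, so the residues are equal and not merely conjugate.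
      change C.along r (Φ.toFun a) (((Trail.incl _ p).append .nil)) =
        (C.pullback hΦ).along (R + r) a p
      rw [SimpleGraph.Walk.append_nil, Cocycle.along_incl,
        Cocycle.along_pullback hR hΦ hC (by omega) (by omega)]
  · refine hp.iterate fun a' => HasPole.image hR hΦ fun C => ?_
    obtain ⟨c, hc⟩ := hsurj (Quotient.mk _ C)
    induction c using Quotient.inductionOn with
    | h C' => exact ⟨C', fun hω ζ => Cocycle.Cohomologous.res_isConj (Quotient.exact hc) hω ζ⟩
  · refine hp.iterate fun a' => HasPole.image hR hΦ fun C => ?_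
    obtain ⟨c, hc⟩ := hsurj (QuotientGroup.mk C)
    induction c using QuotientGroup.induction_on with
    | H C' =>
      refine ⟨C', fun hω ζ => isConj_iff_eq.mpr ?_⟩
      -- Equal classes differ by a trivial factor, whose residue is `1`.
      have htriv : ((C'.pullback hΦ)⁻¹ * C).IsTrivial := QuotientGroup.eq.mp hc
      have h1 := hω.res_mul (C'.pullback hΦ) ((C'.pullback hΦ)⁻¹ * C) ζ
      rw [mul_inv_cancel_left, htriv.res_eq_one hω ζ, mul_one] at h1
      exact h1.symm
  -- Fundamentality applied to `Φ_*C*` gives the case `ε = id`; the others follow by composing with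
  -- `ε`, which commutes with `Φ_*`.
  · obtain ⟨φ, hφ⟩ := hCs Gs (Cs.pullback hΦ)
    exact ⟨φ, fun ε => hφ.comp ε⟩
  · have hω := hp.choose
    obtain ⟨ζ, hζ⟩ := hω.res_ne_one_of_hasPole (hCs H) hp
    -- Powers of `φ` are injective and fix `1`, so the same `ζ` works for every `n`.
    have key := hφ.iterate hR hω fun n => ⟨ζ, fun h1 => hζ (hinj.iterate n
      (h1.trans (Function.iterate_fixed (map_one φ) n).symm))⟩
    exact ⟨fun t => (key t).isDefective, key⟩
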